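/- **Setting.** Consider a Markovian jump linear system $x_{t+1}=A_{\omega(t)}x_t+B_{\omega(t)}u_t$ with $x_t\in\mathbb R^d$, $u_t\in\mathbb R^k$, where $\omega$ is a time-homogeneous Markov chain on $\{1,\dots,N_s\}$ with transition probabilities $p_{ij}$ and initial distribution $\pi$, $\pi_i>0$ for all $i$, and $x_0\sim\mathcal D$ is independent of $\omega$, with finite second moments and $\mathbb E[x_0x_0^\top]\succ0$. Let $Q_i\succ0$ and $R_i\succ0$ for all $i$. For a policy $K=(K_1,\dots,K_{N_s})$, $K_i\in\mathbb R^{k\times d}$, put $u_t=-K_{\omega(t)}x_t$ and $$C(K)=\mathbb E\Big[\sum_{t=0}^\infty x_t^\top Q_{\omega(t)}x_t+u_t^\top R_{\omega(t)}u_t\Big]\in[0,\infty].$$ Let $\nabla C(K)$ be the gradient of $C$ at $K$ for the inner product $\sum_i\operatorname{tr}(V_i^\top S_i)$. For a matrix, $\|\cdot\|$ is the largest singular value; for a tuple $V$, let $\|V\|=\max_i\|V_i\|$, $\|V\|_1=\sum_i\|V_i\|$ and $\Lambda_{\min}(V)=\min_i\sigma_{\min}(V_i)$, with $\sigma_{\min}$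 the smallest singular value. Let $\mu=\min_i\pi_i\,\sigma_{\min}(\mathbb E[x_0x_0^\top])$. **Lemma.** There is a real polynomial $g$ in seven variables, the same for all dimensions $d,k$, all numbers of modes $N_s$ and all systems as above, such that the following holds. If $C(K)<\infty$ and $$\|K'-K\|\le\min\left(\frac{\Lambda_{\min}(Q)\,\mu}{4\,C(K)\sum_{i=1}^{N_s}\|B_i\|\,(\|A_i-B_iK_i\|+1)},\ \sum_{i=1}^{N_s}\|K_i\|\right)$$ (the first term being read as $+\infty$ if its denominator vanishes), then $C(K')<\infty$, $C$ is differentiable at $K$ and at $K'$, and $$\|\nabla C(K')-\nabla C(K)\|_1\le g_{\mathrm{diff}}\,\|K'-K\|,\qquad g_{\mathrm{diff}}=g\Big(\|A\|,\|B\|,\|Q\|,\|R\|,\|K\|,\frac{C(K)}{\Lambda_{\min}(Q)},\frac1\mu\Big).$$ -/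

import Mathlib

/- With this scope open, `‖M‖` is the largest singular value of a real matrix `M` (its `ℓ²`
operator norm); for a tuple `V : Fin N → Matrix _ _ ℝ`, `‖V‖` is then `max_i ‖V i‖`. -/
open scoped Matrix.Norms.L2Operator

noncomputable section

/-- `N`-tuples of real `m × n` matrices. -/
abbrev MatTuple (N m n : ℕ) : Type := Fin N → Matrix (Fin m) (Fin n) ℝ

/-- The norm `‖V‖₁ = ∑ i, ‖V i‖` of a tuple of matrices. -/
def norm1 {N m n : ℕ} (V : MatTuple N m n) : ℝ := ∑ i, ‖V i‖

/-- The smallest singular value of a square matrix. Mathlib lists the singular values in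
decreasing order, with multiplicity, starting from index `0`. -/
def sigmaMin {d : ℕ} (M : Matrix (Fin d) (Fin d) ℝ) : ℝ :=
  (Matrix.toEuclideanLin M).singularValues (d - 1)

/-- `Λ_min(V) = min_i σ_min(V i)`. -/
def lambdaMin {N d : ℕ} (V : MatTuple N d d) : ℝ := ⨅ i, sigmaMin (V i)

/-- The matrix `𝔼[x xᵀ]` of second moments of a distribution on `ℝᵈ`. -/
def secondMoment {d : ℕ} (D : MeasureTheory.Measure (Fin d → ℝ)) : Matrix (Fin d) (Fin d) ℝ :=
  Matrix.of fun a b => ∫ x, x a * x b ∂D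

/-- The data of a quadratic control problem for a Markovian jump linear system with `N` modes,
state space `ℝᵈ` and control space `ℝᵏ`, with its standing assumptions. -/
structure MJLS (N d k : ℕ) where
  /-- state matrices -/
  A : MatTuple N d d
  /-- input matrices -/
  B : MatTuple N d k
  /-- state cost matrices -/
  Q : MatTuple N d d
  /-- control cost matrices -/
  R : MatTuple N k k
  /-- transition probabilities `p i j` of the mode, from `i` to `j` -/
  p : Fin N → Fin N → ℝ
  /-- distribution of the initial mode -/
  init : Fin N → ℝ
  /-- distribution of the initial state -/
  D : MeasureTheory.Measure (Fin d → ℝ)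
  Q_posDef : ∀ i, (Q i).PosDef
  R_posDef : ∀ i, (R i).PosDef
  p_nonneg : ∀ i j, 0 ≤ p i j
  p_sum : ∀ i, ∑ j, p i j = 1
  init_pos : ∀ i, 0 < init i
  init_sum : ∑ i, init i = 1
  D_prob : MeasureTheory.IsProbabilityMeasure D
  D_memLp : MeasureTheory.MemLp id 2 D
  D_posDef : (secondMoment D).PosDef

namespace MJLS

variable {N d k : ℕ}

/-- A policy `K = (K₁, …, K_N)`: in mode `i` the control is `u = -K i x`. -/
abbrev Policy (N d k : ℕ) : Type := MatTuple N k d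

/-- `μ = min_i π_i σ_min(𝔼[x₀ x₀ᵀ])`. -/
def mu (S : MJLS N d k) : ℝ := ⨅ i, S.init i * sigmaMin (secondMoment S.D)

/-- On the probability space `(Ω, ℙ)`, the initial state `x₀` has law `D`, the mode process `w` is
a time-homogeneous Markov chain with initial distribution `init` and transition probabilities `p`
(given through its finite-dimensional laws), and `x₀` is independent of `w`. -/
structure IsRealization (S : MJLS N d k) {Ω : Type*} [MeasurableSpace Ω]
    (ℙ : MeasureTheory.Measure Ω) (x₀ : Ω → Fin d → ℝ) (w : ℕ → Ω → Fin N) : Prop where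
  measurable_x₀ : Measurable x₀
  measurable_w : ∀ t, Measurable (w t)
  law_x₀ : ℙ.map x₀ = S.D
  law_w : ∀ (t : ℕ) (i : ℕ → Fin N),
    ℙ {a | ∀ s ≤ t, w s a = i s} =
      ENNReal.ofReal (S.init (i 0) * ∏ s ∈ Finset.range t, S.p (i s) (i (s + 1)))
  indep : ProbabilityTheory.IndepFun x₀ (fun a t => w t a) ℙ

/-- The control `u = -K_i x` of the policy `K` in mode `i` and state `x`. -/
def control (K : Policy N d k) (i : Fin N) (x : Fin d → ℝ) : Fin k → ℝ :=
  -(Matrix.mulVec (K i) x)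

/-- The state trajectory `x_{t+1} = A_{w t} x_t + B_{w t} u_t`, `u_t = -K_{w t} x_t`, along the mode
path `w`. -/
def state (S : MJLS N d k) (K : Policy N d k) (x : Fin d → ℝ) (w : ℕ → Fin N) : ℕ → Fin d → ℝ
  | 0 => x
  | t + 1 =>
      Matrix.mulVec (S.A (w t)) (S.state K x w t) +
        Matrix.mulVec (S.B (w t)) (control K (w t) (S.state K x w t))

/-- The (nonnegative) running cost `xᵀ Q_i x + uᵀ R_i u` with `u = -K_i x`. -/
def stageCost (S : MJLS N d k) (K : Policy N d k) (i : Fin N) (x : Fin d → ℝ) : ℝ :=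
  x ⬝ᵥ Matrix.mulVec (S.Q i) x + control K i x ⬝ᵥ Matrix.mulVec (S.R i) (control K i x)

/-- The cost `C(K) = 𝔼[∑ t, x_tᵀ Q_{w t} x_t + u_tᵀ R_{w t} u_t] ∈ [0, ∞]` of the policy `K`. -/
def cost (S : MJLS N d k) {Ω : Type*} [MeasurableSpace Ω] (ℙ : MeasureTheory.Measure Ω)
    (x₀ : Ω → Fin d → ℝ) (w : ℕ → Ω → Fin N) (K : Policy N d k) : ENNReal :=
  ∫⁻ a, ∑' t, ENNReal.ofReal
    (S.stageCost K (w t a) (S.state K (x₀ a) (fun s => w s a) t)) ∂ℙ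

/-- The cost as a real number, meaningful where the cost is finite. -/
def realCost (S : MJLS N d k) {Ω : Type*} [MeasurableSpace Ω] (ℙ : MeasureTheory.Measure Ω)
    (x₀ : Ω → Fin d → ℝ) (w : ℕ → Ω → Fin N) (K : Policy N d k) : ℝ :=
  (S.cost ℙ x₀ w K).toReal

/-- The gradient of a function of the policy, for the inner product `∑ i, tr(V_iᵀ S_i)`: the entry
`(a, b)` of its `i`-th matrix is the partial derivative in the entry `(a, b)` of `K_i`. -/
def grad (f : Policy N d k → ℝ) (K : Policy N d k) : MatTuple N k d :=
  fun i => Matrix.of fun a b => fderiv ℝ f K (Pi.single i (Matrix.single a b 1))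

end MJLS

end

/-! Write G_i = A_i - B_i K_i, (L Z)_i = G_iᵀ (∑ j, p_ij Z_j) G_i, T for the adjoint of L under the
trace pairing, X₀ for the initial second moments mode by mode, and Q_K for the stage cost matrices.
The Markov property turns the cost into the series C(K) = ∑ t, ⟨X₀, L^t Q_K⟩ (`cost_eq_tsum`). Since
X₀ ⪰ μ I, finite cost forces P = ∑ t, L^t Q_K to converge, and P - L P = Q_K ⪰ Λ_min(Q) I. Thus P is
a Lyapunov certificate. Such a certificate, of rate c, makes X = ∑ t, T^t X₀ converge and bounds the
inverse of 1 - L on symmetric tuples by ‖P‖ / c (`IsLyapunov.norm_le`), with no dimensional factor.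

On the given ball L' P, with L' the operator of K', differs from L P by at most Λ_min(Q) / 2, so the
same P certifies K' at half the rate (`IsSolution.isLyapunov_of_norm_sub_le`). This yields C(K') < ∞
and controls all quantities at K' by data at K.

For the gradient, C(K') - C(K) = ⟨X', D⟩, where D is the defect of P in the equation of K',
quadratic in K' - K. Its linear part gives the gradient 2 E_i X_i, and X' - X = O(‖K' - K‖) makes
the remainder quadratic (`IsSolution.hasFDerivAt_realCost`). The Lipschitz bound follows from
perturbation bounds for E and X (`IsSolution.norm1_policyGrad_sub_le`), together with μ ‖P‖ ≤ C(K)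
and Λ_min(Q) tr X ≤ C(K). Finally N ≤ C(K) / (Λ_min(Q) μ) (`IsSolution.card_le`) removes the number
of modes from the constant. -/

noncomputable section

namespace MJLS
open Matrix

/-! ### Operator norm, trace and smallest singular value of a matrix -/

section MatrixBounds

variable {n m : ℕ}

lemma abs_dotProduct_mulVec_le (Z : Matrix (Fin n) (Fin n) ℝ) (v : Fin n → ℝ) :
    |v ⬝ᵥ Z *ᵥ v| ≤ ‖Z‖ * (v ⬝ᵥ v) := by
  have h := abs_real_inner_le_norm (WithLp.toLp 2 v) (toEuclideanCLM (𝕜 := ℝ) Z (WithLp.toLp 2 v))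
  rw [inner_toEuclideanCLM] at h
  have h2 := (toEuclideanCLM (𝕜 := ℝ) Z).le_opNorm (WithLp.toLp 2 v)
  rw [l2_opNorm_toEuclideanCLM] at h2
  have h3 : ‖WithLp.toLp 2 v‖ * ‖WithLp.toLp 2 v‖ = v ⬝ᵥ v := by
    rw [← sq, EuclideanSpace.real_norm_sq_eq]
    simp [dotProduct, sq]
  calc _ ≤ _ := h
    _ ≤ ‖WithLp.toLp 2 v‖ * (‖Z‖ * ‖WithLp.toLp 2 v‖) := by gcongr
    _ = _ := by rw [← h3]; ring

/-- For a symmetric matrix the operator norm is the numerical radius. Polarization and the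
parallelogram law pass from the quadratic form to the bilinear form. -/
lemma norm_le_of_abs_dotProduct_le {Z : Matrix (Fin n) (Fin n) ℝ} (hZ : Z.IsHermitian) {c : ℝ}
    (hc : 0 ≤ c) (h : ∀ v : Fin n → ℝ, |v ⬝ᵥ Z *ᵥ v| ≤ c * (v ⬝ᵥ v)) : ‖Z‖ ≤ c := by
  have hsym : ∀ u v : Fin n → ℝ, u ⬝ᵥ Z *ᵥ v = v ⬝ᵥ Z *ᵥ u := by
    intro u v
    rw [dotProduct_mulVec, ← mulVec_transpose, dotProduct_comm,
      ← conjTranspose_eq_transpose_of_trivial, hZ.eq]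
  have hpol : ∀ u v : Fin n → ℝ, 2 * (u ⬝ᵥ Z *ᵥ v) ≤ c * (u ⬝ᵥ u + v ⬝ᵥ v) := by
    intro u v
    have h1 := (abs_le.1 (h (u + v))).2
    have h2 := (abs_le.1 (h (u - v))).1
    have h3 := hsym u v
    simp only [mulVec_add, mulVec_sub, dotProduct_add, add_dotProduct, dotProduct_sub,
      sub_dotProduct] at h1 h2
    nlinarith
  rw [← l2_opNorm_toEuclideanCLM]
  refine ContinuousLinearMap.opNorm_le_bound _ hc fun x => ?_
  set y := toEuclideanCLM (𝕜 := ℝ) Z x with hy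
  by_cases hy0 : ‖y‖ = 0
  · rw [hy0]; positivity
  have hyp : 0 < ‖y‖ := lt_of_le_of_ne (norm_nonneg _) (Ne.symm hy0)
  have hns : ∀ z : EuclideanSpace ℝ (Fin n), z.ofLp ⬝ᵥ z.ofLp = ‖z‖ ^ 2 := by
    intro z
    rw [EuclideanSpace.real_norm_sq_eq]
    simp [dotProduct, sq]
  have hyy : y.ofLp ⬝ᵥ Z *ᵥ x.ofLp = ‖y‖ ^ 2 := by
    rw [← hns y, hy, ofLp_toEuclideanCLM]
  -- Rescaling y to the length of x makes the bound c (|u|² + |v|²) / 2 equal to c |u| |v|.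
  have key := hpol ((‖x‖ / ‖y‖) • y.ofLp) x.ofLp
  rw [smul_dotProduct, smul_dotProduct, dotProduct_smul, hyy, hns, hns] at key
  simp only [smul_eq_mul] at key
  have e1 : ‖x‖ / ‖y‖ * ‖y‖ ^ 2 = ‖x‖ * ‖y‖ := by field_simp
  have e2 : ‖x‖ / ‖y‖ * (‖x‖ * ‖y‖) = ‖x‖ ^ 2 := by field_simp
  rw [e1, e2] at key
  by_cases hx0 : ‖x‖ = 0
  · have : x = 0 := norm_eq_zero.1 hx0
    rw [hy, this]; simp
  have hxp : 0 < ‖x‖ := lt_of_le_of_ne (norm_nonneg _) (Ne.symm hx0)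
  have : ‖x‖ * ‖y‖ ≤ ‖x‖ * (c * ‖x‖) := by nlinarith
  exact le_of_mul_le_mul_left this hxp

open scoped MatrixOrder in
lemma exists_eq_conjTranspose_mul_self {X : Matrix (Fin n) (Fin n) ℝ} (hX : X.PosSemidef) :
    ∃ C : Matrix (Fin n) (Fin n) ℝ, X = Cᴴ * C :=
  CStarAlgebra.nonneg_iff_eq_star_mul_self.1 (nonneg_iff_posSemidef.2 hX)

/-- With X = CᴴC the trace is a sum of values of the form Z at the rows of C. Bounding by tr X
instead of ‖X‖ avoids a factor of the dimension. -/
lemma abs_trace_mul_le {X : Matrix (Fin n) (Fin n) ℝ} (hX : X.PosSemidef)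
    (Z : Matrix (Fin n) (Fin n) ℝ) : |(X * Z).trace| ≤ ‖Z‖ * X.trace := by
  obtain ⟨C, rfl⟩ := exists_eq_conjTranspose_mul_self hX
  have e : ∀ Z : Matrix (Fin n) (Fin n) ℝ, (Cᴴ * C * Z).trace = ∑ a, C a ⬝ᵥ Z *ᵥ C a := by
    intro Z
    rw [mul_assoc, trace_mul_comm, trace]
    refine Finset.sum_congr rfl fun a _ => ?_
    rw [diag_apply, mul_assoc, mul_apply']
    congr 1
  have e1 := e 1
  rw [mul_one] at e1
  rw [e, e1, Finset.mul_sum]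
  refine (Finset.abs_sum_le_sum_abs _ _).trans (Finset.sum_le_sum fun a _ => ?_)
  rw [one_mulVec]
  exact abs_dotProduct_mulVec_le _ _

lemma trace_mul_nonneg {X Z : Matrix (Fin n) (Fin n) ℝ} (hX : X.PosSemidef) (hZ : Z.PosSemidef) :
    0 ≤ (X * Z).trace := by
  obtain ⟨C, rfl⟩ := exists_eq_conjTranspose_mul_self hX
  rw [mul_assoc, trace_mul_comm]
  exact (hZ.mul_mul_conjTranspose_same C).trace_nonneg

lemma trace_mul_vecMulVec (X : Matrix (Fin n) (Fin n) ℝ) (v : Fin n → ℝ) :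
    (X * vecMulVec v v).trace = v ⬝ᵥ X *ᵥ v := by
  rw [mul_vecMulVec, trace_vecMulVec, dotProduct_comm]

lemma trace_vecMulVec_mul (X : Matrix (Fin n) (Fin n) ℝ) (v : Fin n → ℝ) :
    (vecMulVec v v * X).trace = v ⬝ᵥ X *ᵥ v := by
  rw [trace_mul_comm, trace_mul_vecMulVec]

lemma posSemidef_vecMulVec (v : Fin n → ℝ) : (vecMulVec v v).PosSemidef := by
  simpa using posSemidef_vecMulVec_self_star v

lemma norm_vecMulVec_le (v : Fin n → ℝ) : ‖vecMulVec v v‖ ≤ v ⬝ᵥ v := by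
  have hv : 0 ≤ v ⬝ᵥ v := by simpa using dotProduct_star_self_nonneg v
  refine norm_le_of_abs_dotProduct_le (posSemidef_vecMulVec v).1 hv fun u => ?_
  rw [vecMulVec_mulVec, dotProduct_smul, MulOpposite.smul_eq_mul_unop, MulOpposite.unop_op,
    dotProduct_comm u v, abs_mul_self]
  simp only [dotProduct]
  have := Finset.sum_mul_sq_le_sq_mul_sq Finset.univ v u
  simpa [sq] using this

lemma norm_le_trace {X : Matrix (Fin n) (Fin n) ℝ} (hX : X.PosSemidef) : ‖X‖ ≤ X.trace := by
  refine norm_le_of_abs_dotProduct_le hX.1 hX.trace_nonneg fun v => ?_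
  rw [← trace_mul_vecMulVec]
  refine (abs_trace_mul_le hX _).trans ?_
  rw [mul_comm]
  exact mul_le_mul_of_nonneg_left (norm_vecMulVec_le v) hX.trace_nonneg

lemma abs_trace_le (M : Matrix (Fin n) (Fin n) ℝ) : |M.trace| ≤ n * ‖M‖ := by
  have := abs_trace_mul_le (PosSemidef.one (n := Fin n) (R := ℝ)) M
  simpa [mul_comm] using this

lemma norm_conjTranspose_mul_mul_le {l m n o : ℕ} (G : Matrix (Fin m) (Fin l) ℝ)
    (E : Matrix (Fin m) (Fin n) ℝ) (H : Matrix (Fin n) (Fin o) ℝ) :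
    ‖Gᴴ * E * H‖ ≤ ‖G‖ * ‖E‖ * ‖H‖ := by
  refine (l2_opNorm_mul _ _).trans (mul_le_mul_of_nonneg_right ?_ (norm_nonneg _))
  refine (l2_opNorm_mul _ _).trans ?_
  rw [l2_opNorm_conjTranspose]

lemma sigmaMin_nonneg (M : Matrix (Fin n) (Fin n) ℝ) : 0 ≤ sigmaMin M :=
  LinearMap.singularValues_nonneg _ _

lemma sigmaMin_pos {M : Matrix (Fin n) (Fin n) ℝ} (hM : M.PosDef) (hn : 0 < n) :
    0 < sigmaMin M := by
  refine (LinearMap.injective_iff_forall_lt_finrank_singularValues_pos _).1 ?_ _ (by simp; omega)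
  rw [← LinearMap.ker_eq_bot, LinearMap.ker_eq_bot']
  intro x hx
  have hx' : M *ᵥ x.ofLp = 0 := congrArg WithLp.ofLp hx
  by_contra h0
  have h1 : x.ofLp ≠ 0 := fun h => h0 (by ext i; exact congrFun h i)
  have := hM.dotProduct_mulVec_pos h1
  rw [hx'] at this
  simp at this

/-- An eigenvalue of a positive definite matrix is one of its singular values, hence at least the
smallest one. -/
lemma posSemidef_sub_sigmaMin {M : Matrix (Fin n) (Fin n) ℝ} (hM : M.PosDef) :
    (M - sigmaMin M • 1).PosSemidef := by
  rcases Nat.eq_zero_or_pos n with rfl | hn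
  · have : M - sigmaMin M • 1 = 0 := Subsingleton.elim _ _
    rw [this]; exact PosSemidef.zero
  have hH : (M - sigmaMin M • 1).IsHermitian :=
    hM.isHermitian.sub (isHermitian_one.smul (IsSelfAdjoint.all _))
  rw [hH.posSemidef_iff_eigenvalues_nonneg]
  intro i
  set v := hH.eigenvectorBasis i with hv
  have hv0 : v ≠ 0 := by
    intro h
    have := hH.eigenvectorBasis.orthonormal.norm_eq_one i
    rw [← hv, h] at this
    simp at this
  set lam := hH.eigenvalues i
  have h1 : M *ᵥ v.ofLp = (lam + sigmaMin M) • v.ofLp := by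
    have := hH.mulVec_eigenvectorBasis i
    rw [sub_mulVec, smul_mulVec, one_mulVec, sub_eq_iff_eq_add] at this
    rw [add_smul]; exact this
  have hT : toEuclideanLin M v = (lam + sigmaMin M) • v := by
    ext j; exact congrFun h1 j
  have hadj : LinearMap.adjoint (toEuclideanLin M) = toEuclideanLin M := by
    rw [← toEuclideanLin_conjTranspose_eq_adjoint, hM.isHermitian.eq]
  -- Singular values are defined through the eigenvalues of the adjoint composed with the map, so
  -- the eigenvalue enters squared.
  have hev : Module.End.HasEigenvalue (LinearMap.adjoint (toEuclideanLin M) ∘ₗ toEuclideanLin M)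
      (((lam + sigmaMin M) ^ 2 : ℝ)) := by
    refine Module.End.hasEigenvalue_of_hasEigenvector (x := v) ⟨?_, hv0⟩
    rw [Module.End.mem_eigenspace_iff, LinearMap.comp_apply, hadj, hT, map_smul, hT, smul_smul, sq]
  obtain ⟨j, hj⟩ := (toEuclideanLin M).isSymmetric_adjoint_comp_self.exists_eigenvalues_eq
    (n := n) (by simp) hev
  have hj' := (toEuclideanLin M).sq_singularValues_fin (n := n) (by simp) j
  have hle : sigmaMin M ≤ (toEuclideanLin M).singularValues j :=
    (toEuclideanLin M).singularValues_antitone (by omega)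
  have hvv : 0 < v.ofLp ⬝ᵥ v.ofLp := by
    have : v.ofLp ≠ 0 := fun h => hv0 (by ext i; exact congrFun h i)
    simpa using dotProduct_star_self_pos_iff.2 this
  have hpos : 0 ≤ lam + sigmaMin M := by
    have := hM.posSemidef.dotProduct_mulVec_nonneg v.ofLp
    rw [h1] at this
    simp only [star_trivial, dotProduct_smul, smul_eq_mul] at this
    exact nonneg_of_mul_nonneg_left this hvv
  have hsq : (toEuclideanLin M).singularValues j = lam + sigmaMin M := by
    have h2 : (toEuclideanLin M).singularValues j ^ 2 = (lam + sigmaMin M) ^ 2 := by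
      rw [hj']; exact_mod_cast hj
    exact (sq_eq_sq₀ (LinearMap.singularValues_nonneg _ _) hpos).1 h2
  change 0 ≤ lam
  linarith

end MatrixBounds

/-! ### The Lyapunov operator and its adjoint -/

section Operators

variable {N d k : ℕ}

/-- The trace pairing `∑ i, tr(X_i Z_i)` of tuples of matrices. -/
def pair : MatTuple N d d →ₗ[ℝ] MatTuple N d d →ₗ[ℝ] ℝ :=
  LinearMap.mk₂ ℝ (fun X Z => ∑ i, (X i * Z i).trace)
    (fun X Y Z => by simp [add_mul, Finset.sum_add_distrib])
    (fun c X Z => by simp [Finset.mul_sum])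
    (fun X Y Z => by simp [mul_add, Finset.sum_add_distrib])
    (fun c X Z => by simp [Finset.mul_sum])

lemma pair_apply (X Z : MatTuple N d d) : pair X Z = ∑ i, (X i * Z i).trace := rfl

/-- The closed-loop state matrices `A_i - B_i K_i`. -/
def closedLoop (S : MJLS N d k) (K : Policy N d k) : MatTuple N d d := fun i => S.A i - S.B i * K i

/-- The conditional expectation `∑ j, p_ij Z_j` of a tuple after one step of the chain. -/
def modeAvg (S : MJLS N d k) : MatTuple N d d →ₗ[ℝ] MatTuple N d d where
  toFun Z := fun i => ∑ j, S.p i j • Z j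
  map_add' X Z := by ext1 i; simp [Finset.sum_add_distrib]
  map_smul' c Z := by ext1 i; simp [Finset.smul_sum, smul_comm c]

lemma modeAvg_apply (S : MJLS N d k) (Z : MatTuple N d d) (i : Fin N) :
    S.modeAvg Z i = ∑ j, S.p i j • Z j := rfl

/-- The Lyapunov operator of a policy, acting on cost matrices. -/
def lyap (S : MJLS N d k) (K : Policy N d k) : MatTuple N d d →ₗ[ℝ] MatTuple N d d where
  toFun Z := fun i => (S.closedLoop K i)ᴴ * S.modeAvg Z i * S.closedLoop K i
  map_add' X Z := by ext1 i; simp [mul_add, add_mul]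
  map_smul' c Z := by ext1 i; simp

lemma lyap_apply (S : MJLS N d k) (K : Policy N d k) (Z : MatTuple N d d) (i : Fin N) :
    S.lyap K Z i = (S.closedLoop K i)ᴴ * S.modeAvg Z i * S.closedLoop K i := rfl

/-- The adjoint of the Lyapunov operator, acting on second moments of the state. -/
def transfer (S : MJLS N d k) (K : Policy N d k) : MatTuple N d d →ₗ[ℝ] MatTuple N d d where
  toFun X := fun j => ∑ i, S.p i j • (S.closedLoop K i * X i * (S.closedLoop K i)ᴴ)
  map_add' X Z := by ext1 i; simp [mul_add, add_mul, Finset.sum_add_distrib]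
  map_smul' c Z := by ext1 i; simp [Finset.smul_sum, smul_comm c]

lemma transfer_apply (S : MJLS N d k) (K : Policy N d k) (X : MatTuple N d d) (j : Fin N) :
    S.transfer K X j = ∑ i, S.p i j • (S.closedLoop K i * X i * (S.closedLoop K i)ᴴ) := rfl

/-- The stage cost matrices `Q_i + K_iᵀ R_i K_i`. -/
def costMatrix (S : MJLS N d k) (K : Policy N d k) : MatTuple N d d :=
  fun i => S.Q i + (K i)ᴴ * S.R i * K i

/-- The second moments `π_i 𝔼[x₀ x₀ᵀ]` of the initial state, mode by mode. -/
def initMoment (S : MJLS N d k) : MatTuple N d d := fun i => S.init i • secondMoment S.D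

/-- Cyclicity of the trace. This duality moves every estimate between cost matrices and second
moments. -/
lemma pair_transfer (S : MJLS N d k) (K : Policy N d k) (X Z : MatTuple N d d) :
    pair (S.transfer K X) Z = pair X (S.lyap K Z) := by
  simp only [pair_apply, transfer_apply, lyap_apply, modeAvg_apply, Finset.sum_mul, Finset.mul_sum,
    trace_sum]
  rw [Finset.sum_comm]
  refine Finset.sum_congr rfl fun i _ => Finset.sum_congr rfl fun j _ => ?_
  simp only [smul_mul_assoc, mul_smul_comm, trace_smul]
  rw [← mul_assoc, ← mul_assoc, trace_mul_comm _ (S.closedLoop K i)]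
  simp only [mul_assoc]

lemma pair_transfer_pow (S : MJLS N d k) (K : Policy N d k) (t : ℕ) (X Z : MatTuple N d d) :
    pair ((S.transfer K ^ t) X) Z = pair X ((S.lyap K ^ t) Z) := by
  induction t generalizing Z with
  | zero => rfl
  | succ t ih => rw [pow_succ', Module.End.mul_apply, pair_transfer, ih, pow_succ,
      Module.End.mul_apply]

lemma posSemidef_modeAvg (S : MJLS N d k) {Z : MatTuple N d d} (hZ : ∀ i, (Z i).PosSemidef)
    (i : Fin N) : (S.modeAvg Z i).PosSemidef := by
  rw [modeAvg_apply]
  exact  posSemidef_sum Finset.univ fun j _ => (hZ j).smul (S.p_nonneg i j)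

lemma posSemidef_lyap (S : MJLS N d k) (K : Policy N d k) {Z : MatTuple N d d}
    (hZ : ∀ i, (Z i).PosSemidef) (i : Fin N) : (S.lyap K Z i).PosSemidef :=
  (S.posSemidef_modeAvg hZ i).conjTranspose_mul_mul_same _

lemma posSemidef_transfer (S : MJLS N d k) (K : Policy N d k) {X : MatTuple N d d}
    (hX : ∀ i, (X i).PosSemidef) (i : Fin N) : (S.transfer K X i).PosSemidef := by
  rw [transfer_apply]
  exact posSemidef_sum Finset.univ fun j _ =>
    ((hX j).mul_mul_conjTranspose_same _).smul (S.p_nonneg j i)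

lemma posSemidef_lyap_pow (S : MJLS N d k) (K : Policy N d k) {Z : MatTuple N d d}
    (hZ : ∀ i, (Z i).PosSemidef) (t : ℕ) : ∀ i, ((S.lyap K ^ t) Z i).PosSemidef := by
  induction t with
  | zero => exact hZ
  | succ t ih => rw [pow_succ', Module.End.mul_apply]; exact S.posSemidef_lyap K ih

lemma posSemidef_transfer_pow (S : MJLS N d k) (K : Policy N d k) {X : MatTuple N d d}
    (hX : ∀ i, (X i).PosSemidef) (t : ℕ) : ∀ i, ((S.transfer K ^ t) X i).PosSemidef := by
  induction t with
  | zero => exact hX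
  | succ t ih => rw [pow_succ', Module.End.mul_apply]; exact S.posSemidef_transfer K ih

lemma posSemidef_costMatrix (S : MJLS N d k) (K : Policy N d k) (i : Fin N) :
    (S.costMatrix K i).PosSemidef :=
  (S.Q_posDef i).posSemidef.add ((S.R_posDef i).posSemidef.conjTranspose_mul_mul_same _)

lemma posSemidef_initMoment (S : MJLS N d k) (i : Fin N) : (S.initMoment i).PosSemidef :=
  S.D_posDef.posSemidef.smul (S.init_pos i).le

lemma stageCost_eq (S : MJLS N d k) (K : Policy N d k) (i : Fin N) (x : Fin d → ℝ) :
    S.stageCost K i x = x ⬝ᵥ S.costMatrix K i *ᵥ x := by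
  rw [stageCost, control, costMatrix, add_mulVec, dotProduct_add, mulVec_neg, neg_dotProduct_neg,
    ← mulVec_mulVec, ← mulVec_mulVec, conjTranspose_eq_transpose_of_trivial,
    dotProduct_mulVec x (K i)ᵀ, vecMul_transpose]

lemma state_succ (S : MJLS N d k) (K : Policy N d k) (x : Fin d → ℝ) (w : ℕ → Fin N) (t : ℕ) :
    S.state K x w (t + 1) = S.closedLoop K (w t) *ᵥ S.state K x w t := by
  rw [state, control, closedLoop, sub_mulVec, mulVec_neg, ← mulVec_mulVec, sub_eq_add_neg]

end Operators

/-! ### The cost as a series of Lyapunov iterates -/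

section Probability
open MeasureTheory ProbabilityTheory
open scoped ENNReal

variable {N d k : ℕ} {S : MJLS N d k} {Ω : Type*} [MeasurableSpace Ω] {μ : Measure Ω}
  {x₀ : Ω → Fin d → ℝ} {w : ℕ → Ω → Fin N}

/-- The state at time t sees only the modes strictly before t. Hence x_{t+1} is a function of x₀ and
the modes up to t, as conditioning on the mode at t + 1 requires. -/
lemma state_congr (S : MJLS N d k) (K : Policy N d k) (x : Fin d → ℝ) {w w' : ℕ → Fin N} (t : ℕ)
    (h : ∀ s < t, w s = w' s) : S.state K x w t = S.state K x w' t := by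
  induction t with
  | zero => rfl
  | succ t ih => rw [state_succ, state_succ, ih fun s hs => h s (by omega), h t (by omega)]

lemma continuous_state (S : MJLS N d k) (K : Policy N d k) (w : ℕ → Fin N) (t : ℕ) :
    Continuous fun x => S.state K x w t := by
  induction t with
  | zero => exact continuous_id
  | succ t ih =>
    simp_rw [state_succ]
    exact continuous_const.matrix_mulVec ih

lemma measurable_state (h : S.IsRealization μ x₀ w) (K : Policy N d k) (t : ℕ) :
    Measurable fun a => S.state K (x₀ a) (fun s => w s a) t := by
  induction t with
  | zero => exact h.measurable_x₀
  | succ t ih =>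
    simp_rw [state_succ]
    refine measurable_pi_lambda _ fun b => ?_
    simp only [mulVec, dotProduct]
    refine Finset.measurable_sum _ fun c _ => Measurable.mul ?_ ((measurable_pi_apply c).comp ih)
    exact (measurable_of_finite fun i => S.closedLoop K i b c).comp (h.measurable_w t)

lemma measurable_quadratic (h : S.IsRealization μ x₀ w) (K : Policy N d k) (Z : MatTuple N d d)
    (t : ℕ) : Measurable fun a => S.state K (x₀ a) (fun s => w s a) t ⬝ᵥ
      Z (w t a) *ᵥ S.state K (x₀ a) (fun s => w s a) t := by
  have hs := measurable_state h K t
  simp only [mulVec, dotProduct]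
  refine Finset.measurable_sum _ fun b _ => Measurable.mul ((measurable_pi_apply b).comp hs)
    (Finset.measurable_sum _ fun c _ => Measurable.mul ?_ ((measurable_pi_apply c).comp hs))
  exact (measurable_of_finite fun i => Z i b c).comp (h.measurable_w t)

lemma lintegral_path_mul (h : S.IsRealization μ x₀ w) {E : Set (ℕ → Fin N)} (hE : MeasurableSet E)
    {g : (Fin d → ℝ) → ℝ≥0∞} (hg : Measurable g) :
    ∫⁻ a, E.indicator 1 (fun s => w s a) * g (x₀ a) ∂μ =
      μ {a | (fun s => w s a) ∈ E} * ∫⁻ x, g x ∂S.D := by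
  have hw : Measurable fun a s => w s a := measurable_pi_lambda _ h.measurable_w
  have hind : Measurable (E.indicator (1 : (ℕ → Fin N) → ℝ≥0∞)) := measurable_one.indicator hE
  rw [lintegral_mul_eq_lintegral_mul_lintegral_of_indepFun''
    (f := fun a => E.indicator 1 (fun s => w s a)) (g := fun a => g (x₀ a))
    (hind.comp hw).aemeasurable (hg.comp h.measurable_x₀).aemeasurable
    (h.indep.symm.comp hind hg), ← h.law_x₀, lintegral_map hg h.measurable_x₀]
  congr 1
  rw [show (fun a => E.indicator (1 : (ℕ → Fin N) → ℝ≥0∞) (fun s => w s a)) =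
    ((fun a s => w s a) ⁻¹' E).indicator 1 from rfl, lintegral_indicator_one (hw hE)]
  rfl

/-- The Markov property in integrated form. The integral is split over the finitely many mode paths
up to time t. On each cylinder independence separates x₀ from the path, and the finite-dimensional
laws supply the transition factor. -/
lemma lintegral_next_mode (h : S.IsRealization μ x₀ w) (t : ℕ) (j : Fin N)
    {G : (Fin d → ℝ) → (ℕ → Fin N) → ℝ≥0∞} (hG : ∀ v, Measurable fun x => G x v)
    (hdep : ∀ x v v', (∀ s ≤ t, v s = v' s) → G x v = G x v') :
    ∫⁻ a, (if w (t + 1) a = j then G (x₀ a) (fun s => w s a) else 0) ∂μ =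
      ∫⁻ a, ENNReal.ofReal (S.p (w t a) j) * G (x₀ a) (fun s => w s a) ∂μ := by
  classical
  -- A finite path is prolonged by its last mode; the values after t play no role.
  let ext : (Fin (t + 1) → Fin N) → ℕ → Fin N := fun i s => i ⟨min s t, by omega⟩
  let E : (Fin (t + 1) → Fin N) → Set (ℕ → Fin N) := fun i => {v | ∀ s ≤ t, v s = ext i s}
  let E' : (Fin (t + 1) → Fin N) → Set (ℕ → Fin N) :=
    fun i => {v | ∀ s ≤ t + 1, v s = if s ≤ t then ext i s else j}
  have hm : ∀ (n : ℕ) (u : ℕ → Fin N), MeasurableSet {v : ℕ → Fin N | ∀ s ≤ n, v s = u s} := by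
    intro n u
    have : {v : ℕ → Fin N | ∀ s ≤ n, v s = u s} = ⋂ s, ⋂ _ : s ≤ n, (fun v => v s) ⁻¹' {u s} := by
      ext v; simp
    rw [this]
    exact MeasurableSet.iInter fun s => MeasurableSet.iInter fun _ =>
      measurable_pi_apply s (measurableSet_singleton _)
  have hE : ∀ i, MeasurableSet (E i) := fun i => hm _ _
  have hE' : ∀ i, MeasurableSet (E' i) := fun i => hm _ _
  have hmem : ∀ (v : ℕ → Fin N) i, v ∈ E i ↔ (fun s : Fin (t + 1) => v s) = i := by
    intro v i
    constructor
    · intro hv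
      ext1 s
      have := hv s (by omega)
      rw [this]
      simp only [ext]
      congr 1; ext; simp; omega
    · rintro rfl s hs
      simp only [ext]
      congr 1; simp [hs]
  have hmem' : ∀ (v : ℕ → Fin N) i, v ∈ E' i ↔ v ∈ E i ∧ v (t + 1) = j := by
    intro v i
    constructor
    · intro hv
      refine ⟨fun s hs => ?_, ?_⟩
      · have := hv s (by omega)
        rwa [if_pos hs] at this
      · have := hv (t + 1) le_rfl
        rwa [if_neg (by omega)] at this
    · rintro ⟨h1, h2⟩ s hs
      split_ifs with hst
      · exact h1 s hst
      · obtain rfl : s = t + 1 := by omega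
        exact h2
  have hG' : ∀ x v i, v ∈ E i → G x v = G x (ext i) := fun x v i hv => hdep x _ _ hv
  have hself : ∀ a, (fun s => w s a) ∈ E (fun s : Fin (t + 1) => w s a) :=
    fun a => (hmem (fun s => w s a) _).2 rfl
  have e1 : ∀ a, (if w (t + 1) a = j then G (x₀ a) (fun s => w s a) else 0) =
      ∑ i, (E' i).indicator 1 (fun s => w s a) * G (x₀ a) (ext i) := by
    intro a
    rw [Finset.sum_eq_single (fun s : Fin (t + 1) => w s a)]
    · have hin := hself a
      rw [hG' _ _ (fun s : Fin (t + 1) => w s a) hin]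
      simp only [Set.indicator_apply, hmem', hin, true_and]
      split_ifs <;> simp
    · intro i _ hi
      rw [Set.indicator_of_notMem, zero_mul]
      rw [hmem', hmem]
      exact fun h => hi h.1.symm
    · simp
  have e2 : ∀ a, ENNReal.ofReal (S.p (w t a) j) * G (x₀ a) (fun s => w s a) =
      ∑ i, ENNReal.ofReal (S.p (ext i t) j) *
        ((E i).indicator 1 (fun s => w s a) * G (x₀ a) (ext i)) := by
    intro a
    rw [Finset.sum_eq_single (fun s : Fin (t + 1) => w s a)]
    · have hin := hself a
      rw [hG' _ _ (fun s : Fin (t + 1) => w s a) hin, Set.indicator_of_mem hin, Pi.one_apply, one_mul]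
      congr 3
      exact hin t le_rfl
    · intro i _ hi
      rw [Set.indicator_of_notMem, zero_mul, mul_zero]
      rw [hmem]
      exact fun h => hi h.symm
    · simp
  have hw : Measurable fun a s => w s a := measurable_pi_lambda _ h.measurable_w
  have hmeas : ∀ {F : Set (ℕ → Fin N)}, MeasurableSet F → ∀ i, Measurable fun a =>
      F.indicator 1 (fun s => w s a) * G (x₀ a) (ext i) := fun hF i =>
    ((measurable_one.indicator hF).comp hw).mul ((hG _).comp h.measurable_x₀)
  simp_rw [e1, e2]
  rw [lintegral_finsetSum _ fun i _ => hmeas (hE' i) i,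
    lintegral_finsetSum _ fun i _ => (hmeas (hE i) i).const_mul _]
  refine Finset.sum_congr rfl fun i _ => ?_
  rw [lintegral_const_mul _ (hmeas (hE i) i), lintegral_path_mul h (hE' i) (hG _),
    lintegral_path_mul h (hE i) (hG _), ← mul_assoc]
  congr 1
  -- The laws of the two cylinders differ exactly by the factor p (i_t, j).
  have l1 := h.law_w (t + 1) (fun s => if s ≤ t then ext i s else j)
  have l2 := h.law_w t (ext i)
  rw [show μ {a | (fun s => w s a) ∈ E' i} = _ from l1,
    show μ {a | (fun s => w s a) ∈ E i} = _ from l2,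
    ← ENNReal.ofReal_mul (S.p_nonneg _ _), Finset.prod_range_succ]
  congr 1
  rw [Finset.prod_congr rfl (g := fun s => S.p (ext i s) (ext i (s + 1)))]
  · simp; ring
  · intro s hs
    have := Finset.mem_range.1 hs
    rw [if_pos (by omega), if_pos (by omega)]

lemma lintegral_quadratic (S : MJLS N d k) {Z : Matrix (Fin d) (Fin d) ℝ} (hZ : Z.PosSemidef) :
    ∫⁻ x, ENNReal.ofReal (x ⬝ᵥ Z *ᵥ x) ∂S.D = ENNReal.ofReal (secondMoment S.D * Z).trace := by
  have hL : ∀ a : Fin d, MemLp (fun x : Fin d → ℝ => x a) 2 S.D := fun a =>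
    (ContinuousLinearMap.proj (R := ℝ) (φ := fun _ : Fin d => ℝ) a).comp_memLp' S.D_memLp
  have hI : ∀ a b : Fin d, Integrable (fun x : Fin d → ℝ => x a * x b) S.D := fun a b =>
    (hL a).integrable_mul (hL b)
  have e : ∀ x : Fin d → ℝ, x ⬝ᵥ Z *ᵥ x = ∑ a, ∑ b, Z a b * (x a * x b) := by
    intro x
    simp only [dotProduct, mulVec, Finset.mul_sum]
    exact Finset.sum_congr rfl fun a _ => Finset.sum_congr rfl fun b _ => by ring
  rw [← ofReal_integral_eq_lintegral_ofReal]
  · congr 1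
    simp_rw [e]
    rw [integral_finsetSum _ fun a _ => integrable_finsetSum Finset.univ fun b _ =>
      (hI a b).const_mul (Z a b), trace_mul_comm, trace]
    refine Finset.sum_congr rfl fun a _ => ?_
    rw [integral_finsetSum _ fun b _ => (hI a b).const_mul (Z a b), diag_apply, mul_apply]
    refine Finset.sum_congr rfl fun b _ => ?_
    rw [integral_const_mul, secondMoment, of_apply]
    simp_rw [mul_comm]
  · simp_rw [e]
    exact integrable_finsetSum _ fun a _ => integrable_finsetSum _ fun b _ => (hI a b).const_mul _
  · exact Filter.Eventually.of_forall fun x => by simpa using hZ.dotProduct_mulVec_nonneg x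

lemma lintegral_quadratic_init (h : S.IsRealization μ x₀ w) {Z : MatTuple N d d}
    (hZ : ∀ i, (Z i).PosSemidef) :
    ∫⁻ a, ENNReal.ofReal (x₀ a ⬝ᵥ Z (w 0 a) *ᵥ x₀ a) ∂μ =
      ENNReal.ofReal (pair S.initMoment Z) := by
  classical
  let E : Fin N → Set (ℕ → Fin N) := fun i => {v | v 0 = i}
  have hE : ∀ i, MeasurableSet (E i) := fun i =>
    measurable_pi_apply (X := fun _ : ℕ => Fin N) 0 (measurableSet_singleton i)
  have hq : ∀ i, Measurable fun x : Fin d → ℝ => ENNReal.ofReal (x ⬝ᵥ Z i *ᵥ x) := fun i =>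
    (Continuous.measurable (by fun_prop)).ennreal_ofReal
  have e : ∀ a, ENNReal.ofReal (x₀ a ⬝ᵥ Z (w 0 a) *ᵥ x₀ a) =
      ∑ i, (E i).indicator 1 (fun s => w s a) * ENNReal.ofReal (x₀ a ⬝ᵥ Z i *ᵥ x₀ a) := by
    intro a
    rw [Finset.sum_eq_single (w 0 a)]
    · rw [Set.indicator_of_mem (show (fun s => w s a) ∈ E (w 0 a) from rfl), Pi.one_apply, one_mul]
    · intro i _ hi
      rw [Set.indicator_of_notMem (fun h => hi h.symm), zero_mul]
    · simp
  have hw : Measurable fun a s => w s a := measurable_pi_lambda _ h.measurable_w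
  have hm : ∀ i, Measurable fun a =>
      (E i).indicator 1 (fun s => w s a) * ENNReal.ofReal (x₀ a ⬝ᵥ Z i *ᵥ x₀ a) := fun i =>
    ((measurable_one.indicator (hE i)).comp hw).mul ((hq i).comp h.measurable_x₀)
  simp_rw [e]
  rw [lintegral_finsetSum _ fun i _ => hm i, pair_apply, ENNReal.ofReal_sum_of_nonneg fun i _ =>
      trace_mul_nonneg (S.posSemidef_initMoment i) (hZ i)]
  refine Finset.sum_congr rfl fun i _ => ?_
  rw [lintegral_path_mul h (hE i) (hq i), S.lintegral_quadratic (hZ i), initMoment,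
    smul_mul_assoc, trace_smul, smul_eq_mul, ENNReal.ofReal_mul (S.init_pos i).le]
  congr 1
  simpa [E] using h.law_w 0 (fun _ => i)

/-- Averaging over the next mode turns the form Z at x_{t+1} into the form `lyap` Z at x_t. The
induction therefore runs over all Z at once. -/
lemma lintegral_quadratic_state (h : S.IsRealization μ x₀ w) (K : Policy N d k) (t : ℕ)
    {Z : MatTuple N d d} (hZ : ∀ i, (Z i).PosSemidef) :
    ∫⁻ a, ENNReal.ofReal (S.state K (x₀ a) (fun s => w s a) t ⬝ᵥ
      Z (w t a) *ᵥ S.state K (x₀ a) (fun s => w s a) t) ∂μ =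
      ENNReal.ofReal (pair S.initMoment ((S.lyap K ^ t) Z)) := by
  classical
  induction t generalizing Z with
  | zero => exact lintegral_quadratic_init h hZ
  | succ t ih =>
    rw [pow_succ, Module.End.mul_apply, ← ih (S.posSemidef_lyap K hZ)]
    have hc : ∀ (j : Fin N) (v : ℕ → Fin N), Measurable fun x => ENNReal.ofReal
        (S.state K x v (t + 1) ⬝ᵥ Z j *ᵥ S.state K x v (t + 1)) := by
      intro j v
      have := S.continuous_state K v (t + 1)
      exact (Continuous.measurable (by fun_prop)).ennreal_ofReal
    have hm : ∀ j : Fin N, Measurable fun a => ENNReal.ofReal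
        (S.state K (x₀ a) (fun s => w s a) (t + 1) ⬝ᵥ
          Z j *ᵥ S.state K (x₀ a) (fun s => w s a) (t + 1)) := by
      intro j
      have := measurable_state h K (t + 1)
      exact ((Continuous.measurable (f := fun x : Fin d → ℝ => x ⬝ᵥ Z j *ᵥ x)
        (by fun_prop)).comp this).ennreal_ofReal
    have hp : ∀ j : Fin N, Measurable fun a => ENNReal.ofReal (S.p (w t a) j) * ENNReal.ofReal
        (S.state K (x₀ a) (fun s => w s a) (t + 1) ⬝ᵥ
          Z j *ᵥ S.state K (x₀ a) (fun s => w s a) (t + 1)) := fun j =>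
      ((measurable_of_finite fun i => ENNReal.ofReal (S.p i j)).comp (h.measurable_w t)).mul (hm j)
    have e1 : ∀ a, ENNReal.ofReal (S.state K (x₀ a) (fun s => w s a) (t + 1) ⬝ᵥ
        Z (w (t + 1) a) *ᵥ S.state K (x₀ a) (fun s => w s a) (t + 1)) =
        ∑ j, if w (t + 1) a = j then ENNReal.ofReal (S.state K (x₀ a) (fun s => w s a) (t + 1) ⬝ᵥ
          Z j *ᵥ S.state K (x₀ a) (fun s => w s a) (t + 1)) else 0 := by
      intro a; simp
    have e2 : ∀ a, ENNReal.ofReal (S.state K (x₀ a) (fun s => w s a) t ⬝ᵥ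
        S.lyap K Z (w t a) *ᵥ S.state K (x₀ a) (fun s => w s a) t) =
        ∑ j, ENNReal.ofReal (S.p (w t a) j) * ENNReal.ofReal
          (S.state K (x₀ a) (fun s => w s a) (t + 1) ⬝ᵥ
            Z j *ᵥ S.state K (x₀ a) (fun s => w s a) (t + 1)) := by
      intro a
      simp_rw [← ENNReal.ofReal_mul (S.p_nonneg _ _)]
      rw [← ENNReal.ofReal_sum_of_nonneg fun j _ => mul_nonneg (S.p_nonneg _ _)
        (by simpa using (hZ j).dotProduct_mulVec_nonneg _)]
      congr 1
      rw [lyap_apply, ← mulVec_mulVec, ← mulVec_mulVec, dotProduct_mulVec,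
        conjTranspose_eq_transpose_of_trivial, vecMul_transpose, ← S.state_succ K (x₀ a) (fun s => w s a), modeAvg_apply,
        sum_mulVec, dotProduct_sum]
      simp [smul_mulVec]
    simp_rw [e1, e2]
    rw [lintegral_finsetSum _ fun j _ => Measurable.ite (p := fun a => w (t + 1) a = j)
        (h.measurable_w (t + 1) (measurableSet_singleton j)) (hm j) measurable_const,
      lintegral_finsetSum _ fun j _ => hp j]
    refine Finset.sum_congr rfl fun j _ => ?_
    exact lintegral_next_mode h t j (G := fun x v => ENNReal.ofReal
      (S.state K x v (t + 1) ⬝ᵥ Z j *ᵥ S.state K x v (t + 1))) (hc j) fun x v v' hv => by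
        rw [S.state_congr K x (t + 1) fun s hs => hv s (by omega)]

/-- The cost of a policy as a series of Lyapunov iterates of the stage cost. -/
theorem cost_eq_tsum (h : S.IsRealization μ x₀ w) (K : Policy N d k) :
    S.cost μ x₀ w K =
      ∑' t, ENNReal.ofReal (pair S.initMoment ((S.lyap K ^ t) (S.costMatrix K))) := by
  rw [cost]
  simp_rw [stageCost_eq]
  rw [lintegral_tsum fun t => (measurable_quadratic h K _ t).ennreal_ofReal.aemeasurable]
  simp_rw [lintegral_quadratic_state h K _ (S.posSemidef_costMatrix K)]

end Probability

/-! ### Trace estimates and series for tuples of matrices -/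

section TupleBounds

variable {N d k : ℕ}

/-- The total trace `∑ i, tr(X_i)`. -/
def traceSum (X : MatTuple N d d) : ℝ := ∑ i, (X i).trace

lemma traceSum_nonneg {X : MatTuple N d d} (hX : ∀ i, (X i).PosSemidef) : 0 ≤ traceSum X :=
  Finset.sum_nonneg fun i _ => (hX i).trace_nonneg

lemma trace_le_traceSum {X : MatTuple N d d} (hX : ∀ i, (X i).PosSemidef) (i : Fin N) :
    (X i).trace ≤ traceSum X :=
  Finset.single_le_sum (f := fun i => (X i).trace) (fun i _ => (hX i).trace_nonneg)
    (Finset.mem_univ i)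

lemma pair_one (X : MatTuple N d d) : pair X 1 = traceSum X := by
  simp [pair_apply, traceSum]

lemma one_pair (X : MatTuple N d d) : pair 1 X = traceSum X := by
  simp [pair_apply, traceSum]

lemma abs_pair_le {X : MatTuple N d d} (hX : ∀ i, (X i).PosSemidef) (Z : MatTuple N d d) :
    |pair X Z| ≤ ‖Z‖ * traceSum X := by
  rw [pair_apply, traceSum, Finset.mul_sum]
  refine (Finset.abs_sum_le_sum_abs _ _).trans (Finset.sum_le_sum fun i _ => ?_)
  exact (abs_trace_mul_le (hX i) _).trans
    (mul_le_mul_of_nonneg_right (norm_le_pi_norm Z i) (hX i).trace_nonneg)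

/-- This cruder bound needs no positivity. Its factor N d is harmless because it enters only the
proof of differentiability, not the Lipschitz constant. -/
lemma abs_pair_le_norm_mul_norm (X Z : MatTuple N d d) :
    |pair X Z| ≤ N * (d * (‖X‖ * ‖Z‖)) := by
  rw [pair_apply]
  refine (Finset.abs_sum_le_sum_abs _ _).trans ?_
  refine (Finset.sum_le_card_nsmul _ _ (d * (‖X‖ * ‖Z‖)) fun i _ => ?_).trans (by simp)
  refine (abs_trace_le _).trans ?_
  gcongr
  exact (l2_opNorm_mul _ _).trans (by gcongr <;> exact norm_le_pi_norm _ i)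

lemma pair_nonneg {X Z : MatTuple N d d} (hX : ∀ i, (X i).PosSemidef)
    (hZ : ∀ i, (Z i).PosSemidef) : 0 ≤ pair X Z := by
  rw [pair_apply]
  exact Finset.sum_nonneg fun i _ => trace_mul_nonneg (hX i) (hZ i)

lemma norm_le_traceSum {X : MatTuple N d d} (hX : ∀ i, (X i).PosSemidef) : ‖X‖ ≤ traceSum X :=
  (pi_norm_le_iff_of_nonneg (traceSum_nonneg hX)).2 fun i =>
    (norm_le_trace (hX i)).trans (trace_le_traceSum hX i)

/-- The tuple with the rank-one matrix `v vᵀ` in mode `i` and zeros elsewhere. -/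
def atom (i : Fin N) (v : Fin d → ℝ) : MatTuple N d d := Pi.single i (vecMulVec v v)

lemma posSemidef_atom (i : Fin N) (v : Fin d → ℝ) (j : Fin N) : (atom i v j).PosSemidef := by
  rcases eq_or_ne j i with rfl | h
  · rw [atom, Pi.single_eq_same]; exact posSemidef_vecMulVec v
  · rw [atom, Pi.single_eq_of_ne h]; exact PosSemidef.zero

lemma atom_pair (i : Fin N) (v : Fin d → ℝ) (Z : MatTuple N d d) :
    pair (atom i v) Z = v ⬝ᵥ Z i *ᵥ v := by
  rw [pair_apply, Finset.sum_eq_single i]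
  · rw [atom, Pi.single_eq_same, trace_vecMulVec_mul]
  · intro j _ hj
    rw [atom, Pi.single_eq_of_ne hj, zero_mul, trace_zero]
  · simp

lemma pair_atom (i : Fin N) (v : Fin d → ℝ) (Z : MatTuple N d d) :
    pair Z (atom i v) = v ⬝ᵥ Z i *ᵥ v := by
  rw [← atom_pair, pair_apply, pair_apply]
  exact Finset.sum_congr rfl fun i _ => trace_mul_comm _ _

lemma traceSum_atom (i : Fin N) (v : Fin d → ℝ) : traceSum (atom i v) = v ⬝ᵥ v := by
  rw [← pair_one, atom_pair, Pi.one_apply, one_mulVec]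

lemma norm_atom_le (i : Fin N) (v : Fin d → ℝ) : ‖atom i v‖ ≤ v ⬝ᵥ v := by
  rw [← traceSum_atom i v]
  exact norm_le_traceSum (posSemidef_atom i v)

lemma norm_apply_le_of_abs_pair_atom_le {Z : MatTuple N d d} {i : Fin N} (hZ : (Z i).IsHermitian)
    {c : ℝ} (hc : 0 ≤ c) (h : ∀ v, |pair (atom i v) Z| ≤ c * (v ⬝ᵥ v)) : ‖Z i‖ ≤ c :=
  norm_le_of_abs_dotProduct_le hZ hc fun v => by simpa only [atom_pair] using h v

lemma hasSum_pair_right {f : ℕ → MatTuple N d d} {s : MatTuple N d d} (h : HasSum f s)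
    (Y : MatTuple N d d) : HasSum (fun t => pair Y (f t)) (pair Y s) :=
  (LinearMap.toContinuousLinearMap (pair Y)).hasSum h

lemma hasSum_pair_left {f : ℕ → MatTuple N d d} {s : MatTuple N d d} (h : HasSum f s)
    (Z : MatTuple N d d) : HasSum (fun t => pair (f t) Z) (pair s Z) :=
  (LinearMap.toContinuousLinearMap (pair.flip Z)).hasSum h

lemma posSemidef_of_hasSum {f : ℕ → MatTuple N d d} {s : MatTuple N d d} (h : HasSum f s)
    (hf : ∀ t i, (f t i).PosSemidef) (i : Fin N) : (s i).PosSemidef := by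
  have hi := Pi.hasSum.1 h i
  refine PosSemidef.of_dotProduct_mulVec_nonneg ?_ fun v => ?_
  · have h2 := hi.matrix_conjTranspose
    simp_rw [(hf _ i).1.eq] at h2
    exact h2.unique hi
  · rw [star_trivial, ← atom_pair]
    exact (hasSum_pair_right h (atom i v)).nonneg fun t => pair_nonneg (posSemidef_atom i v) (hf t)

/-- On positive semidefinite tuples the norm is at most the trace, so summable traces give absolute
convergence. -/
lemma summable_of_summable_traceSum {f : ℕ → MatTuple N d d} (hf : ∀ t i, (f t i).PosSemidef)
    (h : Summable fun t => traceSum (f t)) : Summable f := by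
  have : CompleteSpace (MatTuple N d d) := FiniteDimensional.complete ℝ _
  exact Summable.of_norm_bounded h fun t => norm_le_traceSum (hf t)

lemma eq_add_of_hasSum_pow {f : MatTuple N d d →ₗ[ℝ] MatTuple N d d} {y x : MatTuple N d d}
    (h : HasSum (fun t => (f ^ t) y) x) : x = y + f x := by
  have h1 : HasSum (fun t => (f ^ (t + 1)) y) (f x) := by
    simp_rw [pow_succ', Module.End.mul_apply]
    exact (LinearMap.toContinuousLinearMap f).hasSum h
  have h2 := (hasSum_nat_add_iff' 1).2 h
  rw [← h2.unique h1]
  simp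

end TupleBounds

/-! ### Lyapunov certificates and the bounds they imply -/

section Lyapunov

variable {N d k : ℕ}

/-- `P` is a Lyapunov certificate of decay rate `c` for the policy `K`. -/
structure IsLyapunov (S : MJLS N d k) (K : Policy N d k) (P : MatTuple N d d) (c : ℝ) : Prop where
  pos : 0 < c
  posSemidef : ∀ i, (P i).PosSemidef
  le_pair : ∀ Y : MatTuple N d d, (∀ i, (Y i).PosSemidef) →
    c * traceSum Y ≤ pair Y (P - S.lyap K P)

variable {S : MJLS N d k} {K : Policy N d k} {P : MatTuple N d d} {c : ℝ}

/-- With Y_t = T^t Y, the certificate gives c tr Y_t ≤ ⟨Y_t, P⟩ - ⟨Y_{t+1}, P⟩, which telescopes. -/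
lemma IsLyapunov.sum_traceSum_le (h : S.IsLyapunov K P c) {Y : MatTuple N d d}
    (hY : ∀ i, (Y i).PosSemidef) (n : ℕ) :
    ∑ t ∈ Finset.range n, traceSum ((S.transfer K ^ t) Y) ≤ pair Y P / c := by
  have key : ∀ n, c * ∑ t ∈ Finset.range n, traceSum ((S.transfer K ^ t) Y) ≤
      pair Y P - pair ((S.transfer K ^ n) Y) P := by
    intro n
    induction n with
    | zero => simp
    | succ n ih =>
      have h1 := h.le_pair _ (S.posSemidef_transfer_pow K hY n)
      rw [map_sub, ← pair_transfer, ← Module.End.mul_apply, ← pow_succ'] at h1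
      rw [Finset.sum_range_succ, mul_add]
      linarith
  rw [le_div_iff₀' h.pos]
  have := pair_nonneg (S.posSemidef_transfer_pow K hY n) h.posSemidef
  linarith [key n]

lemma IsLyapunov.summable_traceSum (h : S.IsLyapunov K P c) {Y : MatTuple N d d}
    (hY : ∀ i, (Y i).PosSemidef) : Summable fun t => traceSum ((S.transfer K ^ t) Y) :=
  summable_of_sum_range_le (fun t => traceSum_nonneg (S.posSemidef_transfer_pow K hY t))
    (h.sum_traceSum_le hY)

/-- The total second moments of the state started from `Y`. -/
lemma IsLyapunov.exists_transfer_solution (h : S.IsLyapunov K P c) {Y : MatTuple N d d}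
    (hY : ∀ i, (Y i).PosSemidef) : ∃ X : MatTuple N d d,
      (∀ i, (X i).PosSemidef) ∧
      X = Y + S.transfer K X ∧ traceSum X ≤ pair Y P / c := by
  obtain ⟨X, hX⟩ := summable_of_summable_traceSum (S.posSemidef_transfer_pow K hY)
    (h.summable_traceSum hY)
  refine ⟨X, posSemidef_of_hasSum hX (S.posSemidef_transfer_pow K hY),
    eq_add_of_hasSum_pow hX, ?_⟩
  have h1 := hasSum_pair_left hX 1
  simp_rw [pair_one] at h1
  rw [← h1.tsum_eq]
  exact Real.tsum_le_of_sum_range_le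
    (fun t => traceSum_nonneg (S.posSemidef_transfer_pow K hY t)) (h.sum_traceSum_le hY)

lemma pair_eq_of_transfer_solution {X Y : MatTuple N d d} (hX : X = Y + S.transfer K X)
    (W : MatTuple N d d) : pair Y W = pair X (W - S.lyap K W) := by
  rw [map_sub, ← pair_transfer, ← LinearMap.sub_apply, ← map_sub]
  congr 2
  rw [eq_sub_iff_add_eq]
  exact hX.symm

/-- Starting the moment recursion from a rank-one tuple v vᵀ in mode i gives X with vᵀ W_i v = ⟨X, W
- L W⟩ and tr X ≤ vᵀ P_i v / c. -/
lemma IsLyapunov.norm_le (h : S.IsLyapunov K P c) {W : MatTuple N d d}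
    (hW : ∀ i, (W i).IsHermitian) : ‖W‖ ≤ ‖W - S.lyap K W‖ * (‖P‖ / c) := by
  have hc := h.pos
  refine (pi_norm_le_iff_of_nonneg (by positivity)).2 fun i => ?_
  refine norm_apply_le_of_abs_pair_atom_le (hW i) (by positivity) fun v => ?_
  obtain ⟨X, hX, hXe, htr⟩ := h.exists_transfer_solution (posSemidef_atom i v)
  rw [pair_eq_of_transfer_solution hXe]
  refine (abs_pair_le hX _).trans ?_
  rw [mul_assoc]
  refine mul_le_mul_of_nonneg_left (htr.trans ?_) (norm_nonneg _)
  rw [div_mul_eq_mul_div]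
  gcongr
  rw [← traceSum_atom i v]
  exact (le_abs_self _).trans (abs_pair_le (posSemidef_atom i v) _)

/-- By duality tr(L^t Z) = ⟨T^t 1, Z⟩ is at most ‖Z‖ tr(T^t 1), which is summable. -/
lemma IsLyapunov.exists_lyap_solution (h : S.IsLyapunov K P c) {Z : MatTuple N d d}
    (hZ : ∀ i, (Z i).PosSemidef) : ∃ W : MatTuple N d d,
      HasSum (fun t => (S.lyap K ^ t) Z) W ∧ (∀ i, (W i).PosSemidef) ∧ W = Z + S.lyap K W := by
  have h1 : ∀ i, ((1 : MatTuple N d d) i).PosSemidef := fun i => PosSemidef.one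
  have hs : Summable fun t => traceSum ((S.lyap K ^ t) Z) := by
    refine Summable.of_nonneg_of_le (fun t => traceSum_nonneg (S.posSemidef_lyap_pow K hZ t))
      (fun t => ?_) ((h.summable_traceSum h1).mul_left ‖Z‖)
    rw [← one_pair, ← pair_transfer_pow]
    exact (le_abs_self _).trans (abs_pair_le (S.posSemidef_transfer_pow K h1 t) _)
  obtain ⟨W, hW⟩ := summable_of_summable_traceSum (S.posSemidef_lyap_pow K hZ) hs
  exact ⟨W, hW, posSemidef_of_hasSum hW (S.posSemidef_lyap_pow K hZ), eq_add_of_hasSum_pow hW⟩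

/-- The difference is tested on a rank-one tuple, written as W - L' W. Both moment equations have
source Y, so the terms ⟨Y, W⟩ cancel and ⟨X, L' W - L W⟩ remains. Only the trace of X enters, and no
factor N d arises. -/
lemma IsLyapunov.norm_transfer_solution_sub_le {K' : Policy N d k} (h : S.IsLyapunov K' P c)
    {X X' Y : MatTuple N d d} (hX : ∀ i, (X i).PosSemidef) (hX' : ∀ i, (X' i).PosSemidef)
    (hXe : X = Y + S.transfer K X) (hXe' : X' = Y + S.transfer K' X') {ε : ℝ} (hε : 0 ≤ ε)
    (hL : ∀ W, ‖S.lyap K' W - S.lyap K W‖ ≤ ε * ‖W‖) (i : Fin N) :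
    ‖X' i - X i‖ ≤ traceSum X * ε * (‖P‖ / c) := by
  have hc := h.pos
  have htr := traceSum_nonneg hX
  refine norm_apply_le_of_abs_pair_atom_le (Z := X' - X) ((hX' i).1.sub (hX i).1) (by positivity)
    fun v => ?_
  obtain ⟨W, -, hW, hWe⟩ := h.exists_lyap_solution (posSemidef_atom i v)
  have hZ : atom i v = W - S.lyap K' W := eq_sub_of_add_eq hWe.symm
  have e : pair (atom i v) (X' - X) = pair X (S.lyap K' W - S.lyap K W) := by
    rw [atom_pair, ← pair_atom, map_sub, LinearMap.sub_apply, hZ,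
      ← pair_eq_of_transfer_solution hXe', pair_eq_of_transfer_solution hXe, ← map_sub]
    congr 1
    abel
  rw [e]
  refine (abs_pair_le hX _).trans ?_
  have hWn := h.norm_le fun i => (hW i).1
  rw [← hZ] at hWn
  calc ‖S.lyap K' W - S.lyap K W‖ * traceSum X
      ≤ (ε * ((v ⬝ᵥ v) * (‖P‖ / c))) * traceSum X := by
        gcongr
        refine (hL W).trans ?_
        gcongr
        refine hWn.trans ?_
        gcongr
        exact norm_atom_le i v
    _ = _ := by ring

end Lyapunov

/-! ### The parameters μ and Λ_min(Q) -/

section Parameters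

variable {N d k : ℕ} (S : MJLS N d k)

lemma modes_pos (S : MJLS N d k) : 0 < N := by
  rcases Nat.eq_zero_or_pos N with rfl | h
  · have := S.init_sum
    simp at this
  · exact h

lemma mu_le (i : Fin N) : S.mu ≤ S.init i * sigmaMin (secondMoment S.D) :=
  ciInf_le (Set.finite_range _).bddBelow i

lemma mu_pos (hd : 0 < d) : 0 < S.mu := by
  have : Nonempty (Fin N) := ⟨⟨0, S.modes_pos⟩⟩
  obtain ⟨i, hi⟩ := exists_eq_ciInf_of_finite (f := fun i => S.init i * sigmaMin (secondMoment S.D))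
  rw [mu, ← hi]
  exact mul_pos (S.init_pos i) (sigmaMin_pos S.D_posDef hd)

lemma lambdaMin_le (i : Fin N) : lambdaMin S.Q ≤ sigmaMin (S.Q i) :=
  ciInf_le (Set.finite_range _).bddBelow i

lemma lambdaMin_pos (hd : 0 < d) : 0 < lambdaMin S.Q := by
  have : Nonempty (Fin N) := ⟨⟨0, S.modes_pos⟩⟩
  obtain ⟨i, hi⟩ := exists_eq_ciInf_of_finite (f := fun i => sigmaMin (S.Q i))
  rw [lambdaMin, ← hi]
  exact sigmaMin_pos (S.Q_posDef i) hd

lemma sigmaMin_mul_trace_le {M Z : Matrix (Fin d) (Fin d) ℝ} (hM : M.PosDef)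
    (hZ : Z.PosSemidef) : sigmaMin M * Z.trace ≤ (M * Z).trace := by
  have := trace_mul_nonneg (posSemidef_sub_sigmaMin hM) hZ
  rw [sub_mul, trace_sub, smul_mul_assoc, one_mul, trace_smul, smul_eq_mul] at this
  linarith

lemma mu_mul_traceSum_le {Z : MatTuple N d d} (hZ : ∀ i, (Z i).PosSemidef) :
    S.mu * traceSum Z ≤ pair S.initMoment Z := by
  rw [traceSum, Finset.mul_sum, pair_apply]
  refine Finset.sum_le_sum fun i _ => ?_
  rw [initMoment, smul_mul_assoc, trace_smul, smul_eq_mul]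
  calc S.mu * (Z i).trace ≤ S.init i * sigmaMin (secondMoment S.D) * (Z i).trace :=
        mul_le_mul_of_nonneg_right (S.mu_le i) (hZ i).trace_nonneg
    _ = S.init i * (sigmaMin (secondMoment S.D) * (Z i).trace) := mul_assoc _ _ _
    _ ≤ _ := mul_le_mul_of_nonneg_left (sigmaMin_mul_trace_le S.D_posDef (hZ i)) (S.init_pos i).le

lemma lambdaMin_mul_traceSum_le (K : Policy N d k) {Y : MatTuple N d d}
    (hY : ∀ i, (Y i).PosSemidef) : lambdaMin S.Q * traceSum Y ≤ pair Y (S.costMatrix K) := by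
  rw [traceSum, Finset.mul_sum, pair_apply]
  refine Finset.sum_le_sum fun i _ => ?_
  rw [costMatrix, mul_add, trace_add, trace_mul_comm]
  have h1 := trace_mul_nonneg (hY i)
    ((S.R_posDef i).posSemidef.conjTranspose_mul_mul_same (K i))
  have h2 := sigmaMin_mul_trace_le (S.Q_posDef i) (hY i)
  have h3 := mul_le_mul_of_nonneg_right (S.lambdaMin_le i) (hY i).trace_nonneg
  linarith

lemma lambdaMin_le_norm (hd : 0 < d) : lambdaMin S.Q ≤ ‖S.Q‖ := by
  let i : Fin N := ⟨0, S.modes_pos⟩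
  refine (S.lambdaMin_le i).trans (le_trans ?_ (norm_le_pi_norm S.Q i))
  have h1 := sigmaMin_mul_trace_le (S.Q_posDef i) (PosSemidef.one (n := Fin d) (R := ℝ))
  have h2 := abs_trace_mul_le (PosSemidef.one (n := Fin d) (R := ℝ)) (S.Q i)
  rw [mul_one] at h1
  rw [one_mul] at h2
  have h3 : (0 : ℝ) < (1 : Matrix (Fin d) (Fin d) ℝ).trace := by simp [hd]
  exact le_of_mul_le_mul_right (h1.trans ((le_abs_self _).trans h2)) h3

/-- Summation of μ ≤ π_i σ_min over the modes, the π_i having sum 1. -/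
lemma card_mul_mu_le : N * S.mu ≤ sigmaMin (secondMoment S.D) := by
  have h := Finset.sum_le_sum fun i (_ : i ∈ Finset.univ) => S.mu_le i
  rw [← Finset.sum_mul, S.init_sum] at h
  simpa using h

lemma sigmaMin_le_traceSum_initMoment (hd : 0 < d) :
    sigmaMin (secondMoment S.D) ≤ traceSum S.initMoment := by
  have e : traceSum S.initMoment = (secondMoment S.D).trace := by
    simp_rw [traceSum, initMoment, trace_smul, smul_eq_mul]
    rw [← Finset.sum_mul, S.init_sum, one_mul]
  rw [e]
  have h := sigmaMin_mul_trace_le S.D_posDef (PosSemidef.one (n := Fin d) (R := ℝ))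
  rw [mul_one, trace_one, Fintype.card_fin] at h
  have hd' : (1 : ℝ) ≤ d := by exact_mod_cast hd
  nlinarith [sigmaMin_nonneg (secondMoment S.D)]

end Parameters

/-! ### Finite cost and solutions of the Lyapunov equations -/

section Solutions
open MeasureTheory

variable {N d k : ℕ} {S : MJLS N d k} {Ω : Type*} [MeasurableSpace Ω] {μ : Measure Ω}
  {x₀ : Ω → Fin d → ℝ} {w : ℕ → Ω → Fin N}

/-- `P` is the cost matrix and `X` the total second moment of the closed loop under `K`. -/
structure IsSolution (S : MJLS N d k) (K : Policy N d k) (P X : MatTuple N d d) : Prop where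
  posSemidef_cost : ∀ i, (P i).PosSemidef
  posSemidef_moment : ∀ i, (X i).PosSemidef
  cost_eq : P = S.costMatrix K + S.lyap K P
  moment_eq : X = S.initMoment + S.transfer K X

variable {K K' : Policy N d k} {P X : MatTuple N d d} {c : ℝ}

lemma isLyapunov_of_eq (hd : 0 < d) (hP : ∀ i, (P i).PosSemidef)
    (hPe : P = S.costMatrix K + S.lyap K P) : S.IsLyapunov K P (lambdaMin S.Q) where
  pos := S.lambdaMin_pos hd
  posSemidef := hP
  le_pair Y hY := by
    rw [sub_eq_of_eq_add hPe]
    exact S.lambdaMin_mul_traceSum_le K hY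

lemma IsSolution.isLyapunov (hd : 0 < d) (h : S.IsSolution K P X) :
    S.IsLyapunov K P (lambdaMin S.Q) :=
  isLyapunov_of_eq hd h.posSemidef_cost h.cost_eq

lemma IsSolution.pair_initMoment (h : S.IsSolution K P X) (W : MatTuple N d d) :
    pair S.initMoment W = pair X (W - S.lyap K W) :=
  pair_eq_of_transfer_solution h.moment_eq W

lemma IsSolution.pair_initMoment_cost (h : S.IsSolution K P X) :
    pair S.initMoment P = pair X (S.costMatrix K) := by
  rw [h.pair_initMoment, sub_eq_of_eq_add h.cost_eq]

lemma cost_eq_of_hasSum (h : S.IsRealization μ x₀ w)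
    (hP : HasSum (fun t => (S.lyap K ^ t) (S.costMatrix K)) P) :
    S.cost μ x₀ w K = ENNReal.ofReal (pair S.initMoment P) := by
  have h1 := hasSum_pair_right hP S.initMoment
  rw [cost_eq_tsum h, ← ENNReal.ofReal_tsum_of_nonneg _ h1.summable, h1.tsum_eq]
  exact fun t => pair_nonneg S.posSemidef_initMoment
    (S.posSemidef_lyap_pow K (S.posSemidef_costMatrix K) t)

lemma realCost_eq_of_hasSum (h : S.IsRealization μ x₀ w)
    (hP : HasSum (fun t => (S.lyap K ^ t) (S.costMatrix K)) P) :
    S.realCost μ x₀ w K = pair S.initMoment P := by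
  rw [realCost, cost_eq_of_hasSum h hP, ENNReal.toReal_ofReal]
  exact pair_nonneg S.posSemidef_initMoment (posSemidef_of_hasSum hP
    (S.posSemidef_lyap_pow K (S.posSemidef_costMatrix K)))

/-- A Lyapunov certificate makes the cost finite. -/
lemma IsLyapunov.exists_isSolution (hK : S.IsLyapunov K P c) (h : S.IsRealization μ x₀ w) :
    S.cost μ x₀ w K ≠ ⊤ ∧ ∃ P' X', S.IsSolution K P' X' ∧
      S.realCost μ x₀ w K = pair S.initMoment P' ∧ traceSum X' ≤ pair S.initMoment P / c := by
  obtain ⟨P', hP', hpos, hPe⟩ := hK.exists_lyap_solution (S.posSemidef_costMatrix K)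
  obtain ⟨X', hXpos, hXe, htr⟩ := hK.exists_transfer_solution S.posSemidef_initMoment
  refine ⟨?_, P', X', ⟨hpos, hXpos, hPe, hXe⟩, realCost_eq_of_hasSum h hP', htr⟩
  rw [cost_eq_of_hasSum h hP']
  exact ENNReal.ofReal_ne_top

/-- Since μ tr Z ≤ ⟨X₀, Z⟩ for Z ⪰ 0, a finite cost makes the traces of the iterates summable. Their
sum is a certificate, and this gives the second moments as well. -/
lemma exists_isSolution_of_cost_ne_top (hd : 0 < d) (h : S.IsRealization μ x₀ w)
    (hK : S.cost μ x₀ w K ≠ ⊤) : ∃ P X, S.IsSolution K P X ∧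
      S.realCost μ x₀ w K = pair S.initMoment P := by
  have hpos := S.posSemidef_lyap_pow K (S.posSemidef_costMatrix K)
  have hnn : ∀ t, 0 ≤ pair S.initMoment ((S.lyap K ^ t) (S.costMatrix K)) := fun t =>
    pair_nonneg S.posSemidef_initMoment (hpos t)
  have hs : Summable fun t => pair S.initMoment ((S.lyap K ^ t) (S.costMatrix K)) := by
    rw [cost_eq_tsum h] at hK
    simpa only [ENNReal.toReal_ofReal (hnn _)] using ENNReal.summable_toReal hK
  have hmu := S.mu_pos hd
  have hs2 : Summable fun t => traceSum ((S.lyap K ^ t) (S.costMatrix K)) := by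
    refine Summable.of_nonneg_of_le (fun t => traceSum_nonneg (hpos t)) (fun t => ?_)
      (hs.div_const S.mu)
    rw [le_div_iff₀' hmu]
    exact S.mu_mul_traceSum_le (hpos t)
  obtain ⟨P, hP⟩ := summable_of_summable_traceSum hpos hs2
  have hLy := isLyapunov_of_eq hd (posSemidef_of_hasSum hP hpos) (eq_add_of_hasSum_pow hP)
  obtain ⟨-, P', X', hsol, he, -⟩ := hLy.exists_isSolution h
  exact ⟨P', X', hsol, he⟩

end Solutions

/-! ### Dependence of the operators on the policy -/

section Perturbation

variable {N d k : ℕ} {S : MJLS N d k} {K K' : Policy N d k}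

lemma norm_conj_sub_conj_le {m n : ℕ} (G H : Matrix (Fin m) (Fin n) ℝ)
    (E : Matrix (Fin m) (Fin m) ℝ) :
    ‖Gᴴ * E * G - Hᴴ * E * H‖ ≤ ‖G - H‖ * ‖E‖ * (‖G‖ + ‖H‖) := by
  have e : Gᴴ * E * G - Hᴴ * E * H = (G - H)ᴴ * E * G + Hᴴ * E * (G - H) := by
    rw [conjTranspose_sub, Matrix.sub_mul, Matrix.sub_mul, Matrix.mul_sub]
    abel
  rw [e]
  refine (norm_add_le _ _).trans ((add_le_add (norm_conjTranspose_mul_mul_le _ _ _)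
    (norm_conjTranspose_mul_mul_le _ _ _)).trans_eq (by ring))

lemma norm_modeAvg_apply_le (S : MJLS N d k) (Z : MatTuple N d d) (i : Fin N) :
    ‖S.modeAvg Z i‖ ≤ ‖Z‖ := by
  rw [modeAvg_apply]
  calc ‖∑ j, S.p i j • Z j‖ ≤ ∑ j, S.p i j * ‖Z‖ := by
        refine norm_sum_le_of_le _ fun j _ => ?_
        rw [norm_smul, Real.norm_of_nonneg (S.p_nonneg i j)]
        exact mul_le_mul_of_nonneg_left (norm_le_pi_norm Z j) (S.p_nonneg i j)
    _ = ‖Z‖ := by rw [← Finset.sum_mul, S.p_sum, one_mul]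

lemma closedLoop_sub (S : MJLS N d k) (K K' : Policy N d k) (i : Fin N) :
    S.closedLoop K' i - S.closedLoop K i = -(S.B i * (K' - K) i) := by
  simp only [closedLoop, Pi.sub_apply, Matrix.mul_sub]
  abel

lemma norm_closedLoop_sub_le (S : MJLS N d k) (K K' : Policy N d k) (i : Fin N) :
    ‖S.closedLoop K' i - S.closedLoop K i‖ ≤ ‖S.B i‖ * ‖K' - K‖ := by
  rw [closedLoop_sub, norm_neg]
  exact (l2_opNorm_mul _ _).trans
    (mul_le_mul_of_nonneg_left (norm_le_pi_norm (K' - K) i) (norm_nonneg _))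

lemma norm_closedLoop_le {κ : ℝ} (hK : ‖K‖ ≤ κ) (i : Fin N) :
    ‖S.closedLoop K i‖ ≤ ‖S.A‖ + ‖S.B‖ * κ := by
  refine (norm_sub_le _ _).trans (add_le_add (norm_le_pi_norm S.A i) ?_)
  refine (l2_opNorm_mul _ _).trans ?_
  gcongr
  · exact norm_le_pi_norm S.B i
  · exact (norm_le_pi_norm K i).trans hK

lemma norm_lyap_sub_apply_le (S : MJLS N d k) (K K' : Policy N d k) (W : MatTuple N d d)
    (i : Fin N) : ‖S.lyap K' W i - S.lyap K W i‖ ≤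
      ‖S.B i‖ * ‖K' - K‖ * ‖W‖ * (‖S.closedLoop K' i‖ + ‖S.closedLoop K i‖) := by
  refine (norm_conj_sub_conj_le _ _ _).trans ?_
  gcongr
  · exact S.norm_closedLoop_sub_le K K' i
  · exact S.norm_modeAvg_apply_le W i

lemma norm_lyap_sub_le {κ : ℝ} (hK : ‖K‖ ≤ κ) (hK' : ‖K'‖ ≤ κ) (W : MatTuple N d d) :
    ‖S.lyap K' W - S.lyap K W‖ ≤
      2 * (‖S.A‖ + ‖S.B‖ * κ) * ‖S.B‖ * ‖K' - K‖ * ‖W‖ := by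
  have hκ : 0 ≤ κ := (norm_nonneg _).trans hK
  refine (pi_norm_le_iff_of_nonneg (by positivity)).2 fun i => ?_
  refine (S.norm_lyap_sub_apply_le K K' W i).trans ?_
  calc _ ≤ ‖S.B‖ * ‖K' - K‖ * ‖W‖ * ((‖S.A‖ + ‖S.B‖ * κ) + (‖S.A‖ + ‖S.B‖ * κ)) := by
        gcongr
        · exact norm_le_pi_norm S.B i
        · exact norm_closedLoop_le hK' i
        · exact norm_closedLoop_le hK i
    _ = _ := by ring

/-- The defect of the cost matrix `P` of `K` in the Lyapunov equation of `K'`. -/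
def costDefect (S : MJLS N d k) (K K' : Policy N d k) (P : MatTuple N d d) : MatTuple N d d :=
  S.costMatrix K' - S.costMatrix K + (S.lyap K' P - S.lyap K P)

lemma norm_costDefect_le {κ : ℝ} (hK : ‖K‖ ≤ κ) (hK' : ‖K'‖ ≤ κ) (P : MatTuple N d d) :
    ‖S.costDefect K K' P‖ ≤
      (2 * κ * ‖S.R‖ + 2 * (‖S.A‖ + ‖S.B‖ * κ) * ‖S.B‖ * ‖P‖) * ‖K' - K‖ := by
  have hκ : 0 ≤ κ := (norm_nonneg _).trans hK
  have h1 : ‖S.costMatrix K' - S.costMatrix K‖ ≤ 2 * κ * ‖S.R‖ * ‖K' - K‖ := by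
    refine (pi_norm_le_iff_of_nonneg (by positivity)).2 fun i => ?_
    have e : (S.costMatrix K' - S.costMatrix K) i =
        (K' i)ᴴ * S.R i * K' i - (K i)ᴴ * S.R i * K i := add_sub_add_left_eq_sub _ _ _
    rw [e]
    refine (norm_conj_sub_conj_le _ _ _).trans ?_
    calc _ ≤ ‖K' - K‖ * ‖S.R‖ * (κ + κ) := by
          gcongr
          · exact norm_le_pi_norm (K' - K) i
          · exact norm_le_pi_norm S.R i
          · exact (norm_le_pi_norm K' i).trans hK'
          · exact (norm_le_pi_norm K i).trans hK
      _ = _ := by ring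
  refine (norm_add_le _ _).trans ((add_le_add h1 (norm_lyap_sub_le hK hK' P)).trans_eq (by ring))

/-- The matrices `E_i` of the policy gradient `2 E_i X_i`. -/
def gainGap (S : MJLS N d k) (K : Policy N d k) (P : MatTuple N d d) : Policy N d k :=
  fun i => S.R i * K i - (S.B i)ᴴ * S.modeAvg P i * S.closedLoop K i

lemma norm_gainGap_apply_le {κ : ℝ} (hK : ‖K‖ ≤ κ) (P : MatTuple N d d) (i : Fin N) :
    ‖S.gainGap K P i‖ ≤ ‖S.R‖ * κ + ‖S.B‖ * ‖P‖ * (‖S.A‖ + ‖S.B‖ * κ) := by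
  have hκ : 0 ≤ κ := (norm_nonneg _).trans hK
  refine (norm_sub_le _ _).trans (add_le_add ((l2_opNorm_mul _ _).trans ?_)
    ((norm_conjTranspose_mul_mul_le _ _ _).trans ?_))
  · gcongr
    · exact norm_le_pi_norm S.R i
    · exact (norm_le_pi_norm K i).trans hK
  · gcongr
    · exact norm_le_pi_norm S.B i
    · exact S.norm_modeAvg_apply_le P i
    · exact norm_closedLoop_le hK i

lemma norm_gainGap_sub_apply_le {κ : ℝ} (hK' : ‖K'‖ ≤ κ) (P P' : MatTuple N d d) (i : Fin N) :
    ‖S.gainGap K' P' i - S.gainGap K P i‖ ≤ ‖S.R‖ * ‖K' - K‖ +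
      ‖S.B‖ * ‖P' - P‖ * (‖S.A‖ + ‖S.B‖ * κ) + ‖S.B‖ * ‖P‖ * (‖S.B‖ * ‖K' - K‖) := by
  have e : S.gainGap K' P' i - S.gainGap K P i = S.R i * (K' - K) i -
      (S.B i)ᴴ * S.modeAvg (P' - P) i * S.closedLoop K' i -
      (S.B i)ᴴ * S.modeAvg P i * (S.closedLoop K' i - S.closedLoop K i) := by
    simp only [gainGap, map_sub, Pi.sub_apply, Matrix.mul_sub, Matrix.sub_mul]
    abel
  rw [e]
  refine (norm_sub_le _ _).trans (add_le_add ((norm_sub_le _ _).trans (add_le_add ?_ ?_)) ?_)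
  · refine (l2_opNorm_mul _ _).trans ?_
    gcongr
    · exact norm_le_pi_norm S.R i
    · exact norm_le_pi_norm (K' - K) i
  · refine (norm_conjTranspose_mul_mul_le _ _ _).trans ?_
    gcongr
    · exact norm_le_pi_norm S.B i
    · exact S.norm_modeAvg_apply_le _ i
    · exact norm_closedLoop_le hK' i
  · refine (norm_conjTranspose_mul_mul_le _ _ _).trans ?_
    gcongr
    · exact norm_le_pi_norm S.B i
    · exact S.norm_modeAvg_apply_le _ i
    · refine (S.norm_closedLoop_sub_le K K' i).trans ?_
      gcongr
      exact norm_le_pi_norm S.B i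

/-- The second-order part of the cost defect. -/
def hessGap (S : MJLS N d k) (K K' : Policy N d k) (P : MatTuple N d d) : MatTuple N d d :=
  fun i => ((K' - K) i)ᴴ * (S.R i + (S.B i)ᴴ * S.modeAvg P i * S.B i) * (K' - K) i

lemma norm_hessGap_le (S : MJLS N d k) (K K' : Policy N d k) (P : MatTuple N d d) :
    ‖S.hessGap K K' P‖ ≤ (‖S.R‖ + ‖S.B‖ * ‖P‖ * ‖S.B‖) * ‖K' - K‖ ^ 2 := by
  refine (pi_norm_le_iff_of_nonneg (by positivity)).2 fun i => ?_
  refine (norm_conjTranspose_mul_mul_le _ _ _).trans ?_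
  calc _ ≤ ‖K' - K‖ * (‖S.R‖ + ‖S.B‖ * ‖P‖ * ‖S.B‖) * ‖K' - K‖ := by
        gcongr
        · exact norm_le_pi_norm (K' - K) i
        · refine (norm_add_le _ _).trans (add_le_add (norm_le_pi_norm S.R i)
            ((norm_conjTranspose_mul_mul_le _ _ _).trans ?_))
          gcongr
          · exact norm_le_pi_norm S.B i
          · exact S.norm_modeAvg_apply_le _ i
          · exact norm_le_pi_norm S.B i
        · exact norm_le_pi_norm (K' - K) i
    _ = _ := by ring

/-- Expansion in Δ = K' - K with G' = G - B Δ. The symmetry of R_i and of the averaged P makes the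
two linear terms transposes of each other. -/
lemma costDefect_apply (S : MJLS N d k) (K K' : Policy N d k) {P : MatTuple N d d}
    (hP : ∀ i, (P i).PosSemidef) (i : Fin N) :
    S.costDefect K K' P i = ((K' - K) i)ᴴ * S.gainGap K P i +
      (S.gainGap K P i)ᴴ * (K' - K) i + S.hessGap K K' P i := by
  have hR : (S.R i)ᴴ = S.R i := (S.R_posDef i).isHermitian.eq
  have hE : (S.modeAvg P i)ᴴ = S.modeAvg P i := (S.posSemidef_modeAvg hP i).1.eq
  have hG : S.closedLoop K' i = S.closedLoop K i - S.B i * (K' - K) i := by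
    rw [sub_eq_add_neg, ← closedLoop_sub]; abel
  have hK : K' i = K i + (K' - K) i := by simp
  simp only [costDefect, Pi.add_apply, Pi.sub_apply, costMatrix, lyap_apply, gainGap, hessGap]
  rw [hG, hK]
  generalize S.closedLoop K i = G
  simp only [Pi.sub_apply, add_sub_cancel_left]
  generalize K' i - K i = Δ
  simp only [conjTranspose_sub, conjTranspose_add, conjTranspose_mul, conjTranspose_conjTranspose,
    hR, hE, Matrix.mul_add, Matrix.add_mul, Matrix.mul_sub, Matrix.sub_mul, Matrix.mul_assoc]
  abel

end Perturbation

/-! ### The ball around a policy and the derivative of the cost -/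

section Gradient
open MeasureTheory

variable {N d k : ℕ} {S : MJLS N d k} {Ω : Type*} [MeasurableSpace Ω] {μ : Measure Ω}
  {x₀ : Ω → Fin d → ℝ} {w : ℕ → Ω → Fin N}
  {K K' : Policy N d k} {P P' X X' : MatTuple N d d} {c : ℝ}

lemma IsSolution.mu_mul_norm_le (h : S.IsSolution K P X) :
    S.mu * ‖P‖ ≤ pair S.initMoment P := by
  refine le_trans ?_ (S.mu_mul_traceSum_le h.posSemidef_cost)
  refine mul_le_mul_of_nonneg_left (norm_le_traceSum h.posSemidef_cost) ?_
  exact Real.iInf_nonneg fun i => mul_nonneg (S.init_pos i).le (sigmaMin_nonneg _)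

/-- Testing the certificate against the identity gives c tr 1 ≤ ⟨1, P⟩ ≤ ‖P‖ tr 1. -/
lemma IsLyapunov.le_norm (hd : 0 < d) (h : S.IsLyapunov K P c) : c ≤ ‖P‖ := by
  have h1 : ∀ i, ((1 : MatTuple N d d) i).PosSemidef := fun i => PosSemidef.one
  have htr : 0 < traceSum (1 : MatTuple N d d) := by
    simp [traceSum, hd, S.modes_pos]
  have h2 := h.le_pair 1 h1
  have h3 := pair_nonneg h1 (S.posSemidef_lyap K h.posSemidef)
  have h4 := (le_abs_self _).trans (abs_pair_le h1 P)
  rw [map_sub] at h2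
  exact le_of_mul_le_mul_right (by linarith) htr

/-- The cost matrix of a policy is a Lyapunov certificate for all policies in an explicit ball. -/
lemma IsSolution.isLyapunov_of_norm_sub_le (hd : 0 < d) (h : S.IsSolution K P X)
    (hball : ‖K' - K‖ * (4 * pair S.initMoment P *
      ∑ i, ‖S.B i‖ * (‖S.A i - S.B i * K i‖ + 1)) ≤ lambdaMin S.Q * S.mu) :
    S.IsLyapunov K' P (lambdaMin S.Q / 2) := by
  have hL := h.isLyapunov hd
  have hmu := S.mu_pos hd
  refine ⟨half_pos hL.pos, h.posSemidef_cost, fun Y hY => ?_⟩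
  have hbound : ‖S.lyap K' P - S.lyap K P‖ ≤ lambdaMin S.Q / 2 := by
    refine (pi_norm_le_iff_of_nonneg (half_pos hL.pos).le).2 fun i => ?_
    refine (S.norm_lyap_sub_apply_le K K' P i).trans ?_
    have hle := hL.le_norm hd
    have hsum : ‖S.B i‖ * (‖S.A i - S.B i * K i‖ + 1) ≤
        ∑ i, ‖S.B i‖ * (‖S.A i - S.B i * K i‖ + 1) :=
      Finset.single_le_sum (f := fun i => ‖S.B i‖ * (‖S.A i - S.B i * K i‖ + 1))
        (fun i _ => by positivity) (Finset.mem_univ i)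
    change ‖S.B i‖ * (‖S.closedLoop K i‖ + 1) ≤ _ at hsum
    have hG : ‖S.closedLoop K' i‖ ≤ ‖S.closedLoop K i‖ + ‖S.B i‖ * ‖K' - K‖ := by
      have := norm_add_le (S.closedLoop K i) (S.closedLoop K' i - S.closedLoop K i)
      rw [add_sub_cancel] at this
      linarith [S.norm_closedLoop_sub_le K K' i]
    set s := ∑ i, ‖S.B i‖ * (‖S.A i - S.B i * K i‖ + 1)
    -- As μ ‖P‖ ≤ C(K), the ball condition gives 4 ‖P‖ u ≤ Λ_min(Q), with u as defined below.
    have h1 : S.mu * (4 * (‖P‖ * (‖K' - K‖ * (‖S.B i‖ * (‖S.closedLoop K i‖ + 1))))) ≤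
        S.mu * lambdaMin S.Q := by
      calc _ = ‖K' - K‖ * (4 * (S.mu * ‖P‖) * (‖S.B i‖ * (‖S.closedLoop K i‖ + 1))) := by ring
        _ ≤ ‖K' - K‖ * (4 * pair S.initMoment P * s) := by
          have := h.mu_mul_norm_le
          have := pair_nonneg S.posSemidef_initMoment h.posSemidef_cost
          gcongr
        _ ≤ _ := hball.trans_eq (mul_comm _ _)
    have h2 := le_of_mul_le_mul_left h1 hmu
    have hP0 : 0 < ‖P‖ := hL.pos.trans_le hle
    set u := ‖K' - K‖ * (‖S.B i‖ * (‖S.closedLoop K i‖ + 1)) with hu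
    -- Here Λ_min(Q) ≤ ‖P‖ is used. Consequently ‖B_i‖ ‖K' - K‖ ≤ 1, so ‖G'_i‖ ≤ ‖G_i‖ + 1, which
    -- accounts for the + 1 in the radius.
    have h3 : u ≤ 1 := by
      have : ‖P‖ * u ≤ ‖P‖ * 1 := by
        have : 0 ≤ ‖P‖ * u := by positivity
        linarith
      exact le_of_mul_le_mul_left this hP0
    have h4 : ‖S.B i‖ * ‖K' - K‖ ≤ 1 := by
      refine le_trans ?_ h3
      have : 0 ≤ ‖S.B i‖ * ‖K' - K‖ * ‖S.closedLoop K i‖ := by positivity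
      rw [hu]; linarith
    calc ‖S.B i‖ * ‖K' - K‖ * ‖P‖ * (‖S.closedLoop K' i‖ + ‖S.closedLoop K i‖)
        ≤ ‖S.B i‖ * ‖K' - K‖ * ‖P‖ * ((‖S.closedLoop K i‖ + 1) + (‖S.closedLoop K i‖ + 1)) := by
          gcongr
          · linarith
          · linarith
      _ = 2 * (‖P‖ * u) := by rw [hu]; ring
      _ ≤ _ := by linarith
  have e : P - S.lyap K' P = S.costMatrix K - (S.lyap K' P - S.lyap K P) := by
    rw [← sub_eq_of_eq_add h.cost_eq]; abel
  rw [e, map_sub]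
  have h1 := S.lambdaMin_mul_traceSum_le K hY
  have h2 := (le_abs_self _).trans (abs_pair_le hY (S.lyap K' P - S.lyap K P))
  have h3 := mul_le_mul_of_nonneg_right hbound (traceSum_nonneg hY)
  linarith

/-- The cost difference formula. -/
lemma IsSolution.pair_sub_pair (h : S.IsSolution K P X) (h' : S.IsSolution K' P' X') :
    pair S.initMoment P' - pair S.initMoment P = pair X' (S.costDefect K K' P) := by
  rw [h'.pair_initMoment_cost, h'.pair_initMoment, ← map_sub, costDefect,
    ← sub_eq_of_eq_add h.cost_eq]
  congr 1
  abel

/-- P' - P solves the Lyapunov equation of K' whose source is the defect of P. -/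
lemma IsSolution.norm_cost_sub_le (h : S.IsSolution K P X) (h' : S.IsSolution K' P' X')
    (hL : S.IsLyapunov K' P c) : ‖P' - P‖ ≤ ‖S.costDefect K K' P‖ * (‖P‖ / c) := by
  have e : S.costDefect K K' P = P' - P - S.lyap K' (P' - P) := by
    rw [costDefect, ← sub_eq_of_eq_add h.cost_eq, ← sub_eq_of_eq_add h'.cost_eq, map_sub]
    abel
  rw [e]
  exact hL.norm_le fun i => (h'.posSemidef_cost i).1.sub (h.posSemidef_cost i).1

lemma IsSolution.norm_moment_sub_apply_le (h : S.IsSolution K P X) (h' : S.IsSolution K' P' X')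
    (hL : S.IsLyapunov K' P c) {κ : ℝ} (hK : ‖K‖ ≤ κ) (hK' : ‖K'‖ ≤ κ) (i : Fin N) :
    ‖X' i - X i‖ ≤ traceSum X * (2 * (‖S.A‖ + ‖S.B‖ * κ) * ‖S.B‖ * ‖K' - K‖) * (‖P‖ / c) := by
  have hκ : 0 ≤ κ := (norm_nonneg _).trans hK
  exact hL.norm_transfer_solution_sub_le h.posSemidef_moment h'.posSemidef_moment h.moment_eq
    h'.moment_eq (by positivity) (norm_lyap_sub_le hK hK') i

/-- The policy gradient `2 E_i X_i`. -/
def policyGrad (S : MJLS N d k) (K : Policy N d k) (P X : MatTuple N d d) : Policy N d k :=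
  fun i => (2 : ℝ) • (S.gainGap K P i * X i)

/-- The linear form `V ↦ ∑ i, tr(G_iᵀ V_i)`. -/
def tracePairing (G : Policy N d k) : Policy N d k →L[ℝ] ℝ :=
  LinearMap.toContinuousLinearMap
    { toFun := fun V => ∑ i, ((G i)ᴴ * V i).trace
      map_add' := fun U V => by simp [Matrix.mul_add, Finset.sum_add_distrib]
      map_smul' := fun c V => by simp [Finset.mul_sum] }

lemma tracePairing_apply (G V : Policy N d k) :
    tracePairing G V = ∑ i, ((G i)ᴴ * V i).trace := rfl

lemma tracePairing_single (G : Policy N d k) (i : Fin N) (a : Fin k) (b : Fin d) :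
    tracePairing G (Pi.single i (Matrix.single a b 1)) = G i a b := by
  rw [tracePairing_apply, Finset.sum_eq_single i]
  · rw [Pi.single_eq_same, trace_mul_comm, trace_single_mul]
    simp
  · intro j _ hj
    rw [Pi.single_eq_of_ne hj, Matrix.mul_zero, trace_zero]
  · simp

/-- Since X is symmetric, both linear terms of the defect have the same trace against X, whence the
factor 2 in the gradient. -/
lemma pair_costDefect (hP : ∀ i, (P i).PosSemidef) (hX : ∀ i, (X i).PosSemidef) :
    pair X (S.costDefect K K' P) =
      tracePairing (S.policyGrad K P X) (K' - K) + pair X (S.hessGap K K' P) := by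
  rw [pair_apply, pair_apply, tracePairing_apply, ← Finset.sum_add_distrib]
  refine Finset.sum_congr rfl fun i _ => ?_
  rw [S.costDefect_apply K K' hP, policyGrad]
  generalize S.gainGap K P i = E
  generalize (K' - K) i = Δ
  have hXi : (X i)ᴴ = X i := (hX i).1.eq
  have e1 : (X i * (Eᴴ * Δ)).trace = ((E * X i)ᴴ * Δ).trace := by
    rw [conjTranspose_mul, hXi, Matrix.mul_assoc]
  have e2 : (X i * (Δᴴ * E)).trace = ((E * X i)ᴴ * Δ).trace := by
    rw [← star_trivial (((E * X i)ᴴ * Δ).trace), ← trace_conjTranspose, conjTranspose_mul,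
      conjTranspose_conjTranspose, ← Matrix.mul_assoc, trace_mul_comm, trace_mul_comm Δᴴ,
      Matrix.mul_assoc]
  rw [Matrix.mul_add, Matrix.mul_add, trace_add, trace_add, e1, e2, conjTranspose_smul,
    Matrix.smul_mul, trace_smul, star_trivial, smul_eq_mul]
  ring

lemma IsSolution.abs_remainder_le (h : S.IsSolution K P X) (h' : S.IsSolution K' P' X') :
    |pair S.initMoment P' - pair S.initMoment P -
      tracePairing (S.policyGrad K P X) (K' - K)| ≤
      N * (d * (‖X' - X‖ * ‖S.costDefect K K' P‖)) + ‖S.hessGap K K' P‖ * traceSum X := by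
  have e : pair S.initMoment P' - pair S.initMoment P -
      tracePairing (S.policyGrad K P X) (K' - K) =
      pair (X' - X) (S.costDefect K K' P) + pair X (S.hessGap K K' P) := by
    rw [h.pair_sub_pair h', map_sub pair, LinearMap.sub_apply,
      pair_costDefect h.posSemidef_cost h.posSemidef_moment]
    ring
  rw [e]
  exact (abs_add_le _ _).trans (add_le_add (abs_pair_le_norm_mul_norm _ _)
    (abs_pair_le h.posSemidef_moment _))

lemma IsSolution.hasFDerivAt_realCost (hd : 0 < d) (hreal : S.IsRealization μ x₀ w)
    (h : S.IsSolution K P X) (hC : S.realCost μ x₀ w K = pair S.initMoment P) :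
    HasFDerivAt (S.realCost μ x₀ w) (tracePairing (S.policyGrad K P X)) K := by
  set κ := ‖K‖ + 1 with hκ
  set γ := ‖S.A‖ + ‖S.B‖ * κ with hγ
  set ℓ := lambdaMin S.Q
  have hℓ : 0 < ℓ := S.lambdaMin_pos hd
  set s := 4 * pair S.initMoment P * ∑ i, ‖S.B i‖ * (‖S.A i - S.B i * K i‖ + 1)
  -- The bound for the quadratic remainder. It may depend on N and d, since only differentiability
  -- is at stake.
  set M := N * (d * (traceSum X * (2 * γ * ‖S.B‖) * (‖P‖ / (ℓ / 2)) *
    (2 * κ * ‖S.R‖ + 2 * γ * ‖S.B‖ * ‖P‖))) +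
    (‖S.R‖ + ‖S.B‖ * ‖P‖ * ‖S.B‖) * traceSum X
  have htr := traceSum_nonneg h.posSemidef_moment
  have hO : (fun K' => S.realCost μ x₀ w K' - S.realCost μ x₀ w K -
      tracePairing (S.policyGrad K P X) (K' - K)) =O[nhds K] fun K' => ‖K' - K‖ ^ 2 := by
    refine Asymptotics.IsBigO.of_bound M ?_
    have ht : Filter.Tendsto (fun K' => ‖K' - K‖) (nhds K) (nhds 0) := by
      have : Continuous fun K' : Policy N d k => ‖K' - K‖ := by fun_prop
      simpa using this.tendsto K
    have ht2 : Filter.Tendsto (fun K' => ‖K' - K‖ * s) (nhds K) (nhds 0) := by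
      simpa using ht.mul_const s
    filter_upwards [ht.eventually_le_const one_pos,
      ht2.eventually_le_const (mul_pos hℓ (S.mu_pos hd))] with K' h1 h2
    have hL := h.isLyapunov_of_norm_sub_le hd h2
    obtain ⟨-, P', X', h', hC', -⟩ := hL.exists_isSolution hreal
    have hKκ : ‖K‖ ≤ κ := by simp [hκ]
    have hKκ' : ‖K'‖ ≤ κ := by
      have := norm_add_le K (K' - K)
      rw [add_sub_cancel] at this
      linarith
    have hX : ‖X' - X‖ ≤ traceSum X * (2 * γ * ‖S.B‖ * ‖K' - K‖) * (‖P‖ / (ℓ / 2)) :=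
      (pi_norm_le_iff_of_nonneg (by positivity)).2 fun i =>
        h.norm_moment_sub_apply_le h' hL hKκ hKκ' i
    rw [hC, hC', Real.norm_eq_abs, norm_pow, norm_norm]
    refine (h.abs_remainder_le h').trans ?_
    calc _ ≤ N * (d * (traceSum X * (2 * γ * ‖S.B‖ * ‖K' - K‖) * (‖P‖ / (ℓ / 2)) *
            ((2 * κ * ‖S.R‖ + 2 * γ * ‖S.B‖ * ‖P‖) * ‖K' - K‖))) +
          (‖S.R‖ + ‖S.B‖ * ‖P‖ * ‖S.B‖) * ‖K' - K‖ ^ 2 * traceSum X := by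
          gcongr
          · exact norm_costDefect_le hKκ hKκ' P
          · exact S.norm_hessGap_le K K' P
      _ = _ := by ring
  exact HasFDerivAt.of_isLittleO (hO.trans_isLittleO
    (Asymptotics.isLittleO_pow_sub_sub K one_lt_two))

lemma grad_eq_of_hasFDerivAt {f : Policy N d k → ℝ} {G : Policy N d k}
    (h : HasFDerivAt f (tracePairing G) K) : grad f K = G := by
  ext i a b
  rw [grad, h.fderiv, of_apply, tracePairing_single]

end Gradient

/-- The Lipschitz constant of the gradient as an expression in `‖A‖, ‖B‖, ‖Q‖, ‖R‖, ‖K‖`,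
`x = C(K) / Λ_min(Q)` and `y = 1 / μ`: here `κ`, `γ` and `q x y` bound the gains, the closed-loop
matrices and the cost matrices. -/
def lipschitzExpr {R : Type*} [CommSemiring R] (a b q r n x y : R) : R :=
  let κ := n * (1 + x * y)
  let γ := a + b * κ
  let p := q * x * y
  let δE := r + b * ((2 * κ * r + 2 * γ * b * p) * (2 * (x * y))) * γ + b * p * b
  let e := r * κ + b * p * γ
  2 * (δE * (2 * x) + x * y * (e * (x * (2 * γ * b) * (2 * (x * y)))))

/-- Read in the polynomial ring the expression is g, read in ℝ it is the constant; evaluation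
carries one to the other. -/
lemma map_lipschitzExpr {R T : Type*} [CommSemiring R] [CommSemiring T] (f : R →+* T)
    (a b q r n x y : R) :
    f (lipschitzExpr a b q r n x y) = lipschitzExpr (f a) (f b) (f q) (f r) (f n) (f x) (f y) := by
  have h2 : f 2 = 2 := map_ofNat f 2
  simp [lipschitzExpr, h2]

/-! ### The Lipschitz bound with constants free of the dimensions -/

section Lipschitz

variable {N d k : ℕ} {S : MJLS N d k} {K K' : Policy N d k} {P P' X X' : MatTuple N d d}

lemma IsSolution.lambdaMin_mul_traceSum_moment_le (h : S.IsSolution K P X) :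
    lambdaMin S.Q * traceSum X ≤ pair S.initMoment P := by
  rw [h.pair_initMoment_cost]
  exact S.lambdaMin_mul_traceSum_le K h.posSemidef_moment

/-- N μ ≤ tr X₀, while Λ_min(Q) tr X₀ ≤ ⟨X₀, P - L P⟩ ≤ ⟨X₀, P⟩ = C(K). -/
lemma IsSolution.card_le (hd : 0 < d) (h : S.IsSolution K P X) :
    (N : ℝ) ≤ pair S.initMoment P / lambdaMin S.Q * (1 / S.mu) := by
  have hmu := S.mu_pos hd
  rw [mul_one_div, le_div_iff₀ hmu, le_div_iff₀' (S.lambdaMin_pos hd)]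
  have h1 := S.card_mul_mu_le.trans (S.sigmaMin_le_traceSum_initMoment hd)
  have h2 := (h.isLyapunov hd).le_pair _ S.posSemidef_initMoment
  have h3 := pair_nonneg S.posSemidef_initMoment (S.posSemidef_lyap K h.posSemidef_cost)
  rw [map_sub] at h2
  have h4 := mul_le_mul_of_nonneg_left h1 (S.lambdaMin_pos hd).le
  linarith

/-- Lipschitz bound for the policy gradient, in terms of the solutions at both policies. -/
lemma IsSolution.norm1_policyGrad_sub_le (hd : 0 < d) (h : S.IsSolution K P X)
    (h' : S.IsSolution K' P' X') (hL : S.IsLyapunov K' P (lambdaMin S.Q / 2))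
    (htr : traceSum X' ≤ pair S.initMoment P / (lambdaMin S.Q / 2))
    (hKK : ‖K' - K‖ ≤ ∑ i, ‖K i‖) :
    norm1 (S.policyGrad K' P' X' - S.policyGrad K P X) ≤
      lipschitzExpr ‖S.A‖ ‖S.B‖ ‖S.Q‖ ‖S.R‖ ‖K‖ (pair S.initMoment P / lambdaMin S.Q) (1 / S.mu) *
        ‖K' - K‖ := by
  have hmu := S.mu_pos hd
  have hΛ := S.lambdaMin_pos hd
  have hC0 := pair_nonneg S.posSemidef_initMoment h.posSemidef_cost
  have hN := h.card_le hd
  set x := pair S.initMoment P / lambdaMin S.Q with hx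
  set y := 1 / S.mu with hy
  have hx0 : 0 ≤ x := by positivity
  have hy0 : 0 ≤ y := by positivity
  have hP2 : ‖P‖ / (lambdaMin S.Q / 2) ≤ 2 * (x * y) := by
    have h1 : ‖P‖ ≤ pair S.initMoment P * y := by
      rw [hy, mul_one_div, le_div_iff₀' hmu]
      exact h.mu_mul_norm_le
    calc ‖P‖ / (lambdaMin S.Q / 2) = 2 * (‖P‖ / lambdaMin S.Q) := by field_simp
      _ ≤ 2 * (pair S.initMoment P * y / lambdaMin S.Q) := by gcongr
      _ = _ := by rw [hx]; ring
  -- C(K) itself is not an argument of g: ‖P‖ ≤ C(K) y is rewritten through C(K) = Λ_min(Q) x and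
  -- Λ_min(Q) ≤ ‖Q‖.
  have hP : ‖P‖ ≤ ‖S.Q‖ * x * y := by
    calc ‖P‖ = lambdaMin S.Q / 2 * (‖P‖ / (lambdaMin S.Q / 2)) := by field_simp
      _ ≤ ‖S.Q‖ / 2 * (2 * (x * y)) := by
        gcongr
        exact S.lambdaMin_le_norm hd
      _ = _ := by ring
  have hX : traceSum X ≤ x := by
    rw [hx, le_div_iff₀' hΛ]; exact h.lambdaMin_mul_traceSum_moment_le
  have hX' : traceSum X' ≤ 2 * x := htr.trans_eq (by rw [hx]; field_simp)
  clear_value x y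
  set κ := ‖K‖ * (1 + x * y) with hκ
  clear_value κ
  have hκ0 : 0 ≤ κ := by rw [hκ]; positivity
  have hK : ‖K‖ ≤ κ := by
    rw [hκ]
    exact le_mul_of_one_le_right (norm_nonneg _) (by simpa using mul_nonneg hx0 hy0)
  -- ‖K'‖ ≤ ‖K‖ + ∑ i, ‖K_i‖ ≤ (1 + N) ‖K‖, and N ≤ x y.
  have hK' : ‖K'‖ ≤ κ := by
    have h1 := norm_add_le K (K' - K)
    rw [add_sub_cancel] at h1
    have h2 : ∑ i, ‖K i‖ ≤ N * ‖K‖ :=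
      (Finset.sum_le_card_nsmul _ _ _ fun i _ => norm_le_pi_norm K i).trans_eq (by simp)
    have h3 := mul_le_mul_of_nonneg_right hN (norm_nonneg K)
    rw [hκ]
    linarith
  set γ := ‖S.A‖ + ‖S.B‖ * κ with hγ
  have hγ0 : 0 ≤ γ := by positivity
  set δ := ‖K' - K‖
  have hδ0 : 0 ≤ δ := norm_nonneg _
  set p := ‖S.Q‖ * x * y with hp
  have hp0 : 0 ≤ p := by positivity
  clear_value γ p
  have hγle : ‖S.A‖ + ‖S.B‖ * κ ≤ γ := hγ.ge
  have hD : ‖S.costDefect K K' P‖ ≤ (2 * κ * ‖S.R‖ + 2 * γ * ‖S.B‖ * p) * δ := by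
    refine (norm_costDefect_le hK hK' P).trans ?_
    gcongr
  have hPP : ‖P' - P‖ ≤ (2 * κ * ‖S.R‖ + 2 * γ * ‖S.B‖ * p) * δ * (2 * (x * y)) := by
    refine (h.norm_cost_sub_le h' hL).trans ?_
    gcongr
  have hXX : ∀ i, ‖X' i - X i‖ ≤ x * (2 * γ * ‖S.B‖ * δ) * (2 * (x * y)) := fun i => by
    refine (h.norm_moment_sub_apply_le h' hL hK hK' i).trans ?_
    gcongr
  have hE : ∀ i, ‖S.gainGap K P i‖ ≤ ‖S.R‖ * κ + ‖S.B‖ * p * γ := fun i => by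
    refine (norm_gainGap_apply_le hK P i).trans ?_
    gcongr
  set δE := ‖S.R‖ + ‖S.B‖ * ((2 * κ * ‖S.R‖ + 2 * γ * ‖S.B‖ * p) * (2 * (x * y))) * γ +
    ‖S.B‖ * p * ‖S.B‖ with hδE
  have hδE0 : 0 ≤ δE := by rw [hδE]; positivity
  clear_value δE
  have hEE : ∀ i, ‖S.gainGap K' P' i - S.gainGap K P i‖ ≤ δE * δ := fun i => by
    refine (norm_gainGap_sub_apply_le hK' P P' i).trans ?_
    calc _ ≤ ‖S.R‖ * δ + ‖S.B‖ * ((2 * κ * ‖S.R‖ + 2 * γ * ‖S.B‖ * p) * δ * (2 * (x * y))) * γ +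
          ‖S.B‖ * p * (‖S.B‖ * δ) := by gcongr
      _ = _ := by rw [hδE]; ring
  set e := ‖S.R‖ * κ + ‖S.B‖ * p * γ with he
  have he0 : 0 ≤ e := by rw [he]; positivity
  clear_value e
  -- E' X' - E X = (E' - E) X' + E (X' - X). Keeping tr X'_i in the first term lets the sum over
  -- modes become the total trace, at most 2 x. Only the second term costs a factor N ≤ x y.
  have hi : ∀ i, ‖(S.policyGrad K' P' X' - S.policyGrad K P X) i‖ ≤
      2 * (δE * δ * (X' i).trace + e * (x * (2 * γ * ‖S.B‖ * δ) * (2 * (x * y)))) := fun i => by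
    have e1 : (S.policyGrad K' P' X' - S.policyGrad K P X) i =
        (2 : ℝ) • ((S.gainGap K' P' i - S.gainGap K P i) * X' i +
          S.gainGap K P i * (X' i - X i)) := by
      simp only [policyGrad, Pi.sub_apply, Matrix.sub_mul, Matrix.mul_sub, ← smul_sub]
      congr 1
      abel
    rw [e1, norm_smul, Real.norm_of_nonneg zero_le_two]
    refine mul_le_mul_of_nonneg_left ((norm_add_le _ _).trans (add_le_add
      ((l2_opNorm_mul _ _).trans ?_) ((l2_opNorm_mul _ _).trans ?_))) zero_le_two
    · gcongr
      · exact hEE i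
      · exact norm_le_trace (h'.posSemidef_moment i)
    · gcongr
      · exact hE i
      · exact hXX i
  have heq : lipschitzExpr ‖S.A‖ ‖S.B‖ ‖S.Q‖ ‖S.R‖ ‖K‖ x y =
      2 * (δE * (2 * x) + x * y * (e * (x * (2 * γ * ‖S.B‖) * (2 * (x * y))))) := by
    rw [he, hδE, hp, hγ, hκ]
    rfl
  rw [heq]
  calc norm1 (S.policyGrad K' P' X' - S.policyGrad K P X)
      ≤ ∑ i, 2 * (δE * δ * (X' i).trace +
          e * (x * (2 * γ * ‖S.B‖ * δ) * (2 * (x * y)))) := Finset.sum_le_sum fun i _ => hi i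
    _ = 2 * (δE * δ * traceSum X' +
          N * (e * (x * (2 * γ * ‖S.B‖ * δ) * (2 * (x * y))))) := by
        rw [← Finset.mul_sum, Finset.sum_add_distrib, ← Finset.mul_sum, traceSum]
        simp
    _ ≤ 2 * (δE * δ * (2 * x) +
          x * y * (e * (x * (2 * γ * ‖S.B‖ * δ) * (2 * (x * y))))) := by gcongr
    _ = _ := by ring

end Lipschitz
end MJLS
end

/-- The bound `‖K' - K‖ ≤ Λ_min(Q) μ / (4 C(K) ∑ i, ‖B_i‖ (‖A_i - B_i K_i‖ + 1))` is written without
a division, so that it is no restriction when all `B_i` vanish. -/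
theorem mainTheorem5 :
    ∃ g : MvPolynomial (Fin 7) ℝ,
      ∀ (N d k : ℕ) (S : MJLS N d k) (Ω : Type*) [MeasurableSpace Ω]
        (ℙ : MeasureTheory.Measure Ω) [MeasureTheory.IsProbabilityMeasure ℙ]
        (x₀ : Ω → Fin d → ℝ) (w : ℕ → Ω → Fin N), S.IsRealization ℙ x₀ w →
      ∀ K K' : MJLS.Policy N d k,
        S.cost ℙ x₀ w K ≠ ⊤ →
        ‖K' - K‖ * (4 * S.realCost ℙ x₀ w K * ∑ i, ‖S.B i‖ * (‖S.A i - S.B i * K i‖ + 1))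
          ≤ lambdaMin S.Q * S.mu →
        ‖K' - K‖ ≤ ∑ i, ‖K i‖ →
        S.cost ℙ x₀ w K' ≠ ⊤ ∧
        DifferentiableAt ℝ (S.realCost ℙ x₀ w) K ∧
        DifferentiableAt ℝ (S.realCost ℙ x₀ w) K' ∧
        norm1 (MJLS.grad (S.realCost ℙ x₀ w) K' - MJLS.grad (S.realCost ℙ x₀ w) K) ≤
          MvPolynomial.eval ![‖S.A‖, ‖S.B‖, ‖S.Q‖, ‖S.R‖, ‖K‖,
            S.realCost ℙ x₀ w K / lambdaMin S.Q, 1 / S.mu] g * ‖K' - K‖ := by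
  refine ⟨MJLS.lipschitzExpr (MvPolynomial.X 0) (MvPolynomial.X 1) (MvPolynomial.X 2)
    (MvPolynomial.X 3) (MvPolynomial.X 4) (MvPolynomial.X 5) (MvPolynomial.X 6), ?_⟩
  intro N d k S Ω _ ℙ _ x₀ w hreal K K' hK hball hKK
  -- For d = 0 the policies form a single point; the positivity of μ and Λ_min(Q) needs d > 0.
  rcases Nat.eq_zero_or_pos d with rfl | hd
  · obtain rfl : K' = K := Subsingleton.elim _ _
    have hdiff : DifferentiableAt ℝ (S.realCost ℙ x₀ w) K' :=
      (hasFDerivAt_of_subsingleton _ _).differentiableAt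
    exact ⟨hK, hdiff, hdiff, by simp [norm1]⟩
  obtain ⟨P, X, h, hC⟩ := MJLS.exists_isSolution_of_cost_ne_top hd hreal hK
  rw [hC] at hball
  have hL := h.isLyapunov_of_norm_sub_le hd hball
  obtain ⟨hK', P', X', h', hC', htr⟩ := hL.exists_isSolution hreal
  have hF := h.hasFDerivAt_realCost hd hreal hC
  have hF' := h'.hasFDerivAt_realCost hd hreal hC'
  refine ⟨hK', hF.differentiableAt, hF'.differentiableAt, ?_⟩
  rw [MJLS.grad_eq_of_hasFDerivAt hF, MJLS.grad_eq_of_hasFDerivAt hF', hC, MJLS.map_lipschitzExpr]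
  simp only [MvPolynomial.eval_X]
  exact h.norm1_policyGrad_sub_le hd h' hL htr hKK
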